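/- Let $a,b\in\mathbb{C}(z)$, and let $L$ be a Picard--Vessiot extension of $(\mathbb{C}(z),\partial_z=d/dz)$ for $$\mathcal L_z:\quad \partial_z^2y+a(z)\,\partial_zy+b(z)\,y=0. \qquad (1)$$ (A Picard--Vessiot extension of a differential field $F\supseteq\mathbb{C}$ for a second order linear homogeneous equation is a differential field extension of $F$ whose field of constants is $\mathbb{C}$ and which is generated over $F$ by $y_1,y_2$ and their first derivatives, where $(y_1,y_2)$ is a fundamental system, that is, a $\mathbb{C}$-basis of the space of solutions.) Let $(K,\delta)$ be a differential field with field of constants $\mathbb{C}$, let $\theta\in K$ be non-constant, put $\partial_x=\delta$, and let $K_0=\mathbb{C}\langle\theta\rangle\subseteq K$ be the smallest differential field containing $\mathbb{C}$ and $\theta$. Then there is a $\mathbb{C}$-embedding $\iota:\mathbb{C}(z)\to K_0$, $z\mapsto\theta$; write $f(\theta)=\iota(f)$. (i) The change of variable $z=\theta(x)$ transforms (1) into $$\mathcal L_x:\quad \partial_x^2r+\Big(a(\theta)\,\partial_x\theta-\frac{\partial_x^2\theta}{\partial_x\theta}\Big)\partial_xr+b(\theta)(\partial_x\theta)^2\,r=0,\qquad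 r=y\circ\theta, \qquad (2)$$ whose coefficients lie in $K_0$. That is, if $E$ is a differential field extension of $\mathbb{C}(z)$, $M$ a differential field extension of $K_0$, and $\varphi:E\to M$ a substitution $y\mapsto y\circ\theta$ (a $\mathbb{C}$-embedding with $\varphi(z)=\theta$ and $\partial_x(\varphi(f))=\partial_x\theta\cdot\varphi(\partial_zf)$ for all $f\in E$), then $\mathcal L_x(\varphi(y))=(\partial_x\theta)^2\,\varphi(\mathcal L_z(y))$ for all $y\in E$, where $\mathcal L_x$ and $\mathcal L_z$ also denote the left-hand sides. (ii) Let $L_0$ be a Picard--Vessiot extension of $K_0$ for (2). A substitution $\varphi:L\to L_0$ exists, and every such $\varphi$ maps each fundamental system $(y_1,y_2)$ of (1) in $L$ to a fundamental system $(\varphi(y_1),\varphi(y_2))$ of (2) in $L_0$. If $K_0$ is algebraic over $\iota(\mathbb{C}(z))=\mathbb{C}(\theta)$, then $$(\mathrm{DGal}(L_0/K_0))^0=(\mathrm{DGal}(L/\mathbb{C}(z)))^0,$$ as subgroups of $\mathrm{GL}(2,\mathbb{C})$, where the differential Galois groups are represented as matrix groups by means of $(\varphi(y_1),\varphi(y_2))$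 and $(y_1,y_2)$ respectively, and $G^0$ denotes the connected component of the identity of $G$ in the Zariski topology. -/

import Mathlib

universe u v w

open scoped Differential

noncomputable section

/-- A differential ring from an additive map that satisfies the Leibniz rule. -/
@[reducible]
def differentialOfLeibniz {R : Type*} [CommRing R] (D : R → R)
    (hadd : ∀ f g, D (f + g) = D f + D g) (hmul : ∀ f g, D (f * g) = f * D g + g * D f) :
    Differential R where
  deriv := Derivation.mk' (AddMonoidHom.toIntLinearMap (AddMonoidHom.mk' D hadd)) hmul

/-! ### The differential field `(ℂ(z), d/dz)` -/

/-- The derivative `d/dz` of a rational function, by the quotient rule. -/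
def ratFuncDeriv (f : RatFunc ℂ) : RatFunc ℂ :=
  (algebraMap (Polynomial ℂ) (RatFunc ℂ) (Polynomial.derivative f.num) *
      algebraMap (Polynomial ℂ) (RatFunc ℂ) f.denom -
    algebraMap (Polynomial ℂ) (RatFunc ℂ) f.num *
      algebraMap (Polynomial ℂ) (RatFunc ℂ) (Polynomial.derivative f.denom)) /
    algebraMap (Polynomial ℂ) (RatFunc ℂ) f.denom ^ 2

/-- The quotient rule holds for every representation of a rational function as a fraction. -/
theorem ratFuncDeriv_div (p q : Polynomial ℂ) (hq : q ≠ 0) :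
    ratFuncDeriv (algebraMap (Polynomial ℂ) (RatFunc ℂ) p / algebraMap (Polynomial ℂ) (RatFunc ℂ) q) =
      (algebraMap (Polynomial ℂ) (RatFunc ℂ) (Polynomial.derivative p) *
          algebraMap (Polynomial ℂ) (RatFunc ℂ) q -
        algebraMap (Polynomial ℂ) (RatFunc ℂ) p *
          algebraMap (Polynomial ℂ) (RatFunc ℂ) (Polynomial.derivative q)) /
        algebraMap (Polynomial ℂ) (RatFunc ℂ) q ^ 2 := by
  set f : RatFunc ℂ :=
    algebraMap (Polynomial ℂ) (RatFunc ℂ) p / algebraMap (Polynomial ℂ) (RatFunc ℂ) q with hf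
  have hinj := RatFunc.algebraMap_injective ℂ
  have hd : f.denom ≠ 0 := f.denom_ne_zero
  have hq' : algebraMap (Polynomial ℂ) (RatFunc ℂ) q ≠ 0 := RatFunc.algebraMap_ne_zero hq
  have hd' : algebraMap (Polynomial ℂ) (RatFunc ℂ) f.denom ≠ 0 := RatFunc.algebraMap_ne_zero hd
  have h1 : f.num * q = p * f.denom := by
    apply hinj
    rw [map_mul, map_mul]
    have h2 := f.num_div_denom
    rw [div_eq_iff hd'] at h2
    rw [h2, hf]
    field_simp
  have h3 := congrArg Polynomial.derivative h1
  simp only [Polynomial.derivative_mul] at h3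
  have h1' := congrArg (algebraMap (Polynomial ℂ) (RatFunc ℂ)) h1
  have h3' := congrArg (algebraMap (Polynomial ℂ) (RatFunc ℂ)) h3
  simp only [map_mul, map_add] at h1' h3'
  unfold ratFuncDeriv
  rw [div_eq_div_iff (pow_ne_zero 2 hd') (pow_ne_zero 2 hq')]
  linear_combination
    (algebraMap (Polynomial ℂ) (RatFunc ℂ) q * algebraMap (Polynomial ℂ) (RatFunc ℂ) f.denom) * h3' -
    (algebraMap (Polynomial ℂ) (RatFunc ℂ) (Polynomial.derivative f.denom) *
        algebraMap (Polynomial ℂ) (RatFunc ℂ) q +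
      algebraMap (Polynomial ℂ) (RatFunc ℂ) f.denom *
        algebraMap (Polynomial ℂ) (RatFunc ℂ) (Polynomial.derivative q)) * h1'

theorem ratFuncDeriv_add (f g : RatFunc ℂ) :
    ratFuncDeriv (f + g) = ratFuncDeriv f + ratFuncDeriv g := by
  induction f using RatFunc.induction_on with
  | f p q hq =>
    induction g using RatFunc.induction_on with
    | f r s hs =>
      have hq' := RatFunc.algebraMap_ne_zero (K := ℂ) hq
      have hs' := RatFunc.algebraMap_ne_zero (K := ℂ) hs
      rw [div_add_div _ _ hq' hs', ← map_mul, ← map_mul, ← map_mul, ← map_add,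
        ratFuncDeriv_div _ _ (mul_ne_zero hq hs), ratFuncDeriv_div _ _ hq, ratFuncDeriv_div _ _ hs]
      simp only [Polynomial.derivative_mul, map_mul, map_add]
      field_simp
      ring

theorem ratFuncDeriv_mul (f g : RatFunc ℂ) :
    ratFuncDeriv (f * g) = f * ratFuncDeriv g + g * ratFuncDeriv f := by
  induction f using RatFunc.induction_on with
  | f p q hq =>
    induction g using RatFunc.induction_on with
    | f r s hs =>
      have hq' := RatFunc.algebraMap_ne_zero (K := ℂ) hq
      have hs' := RatFunc.algebraMap_ne_zero (K := ℂ) hs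
      rw [div_mul_div_comm, ← map_mul, ← map_mul,
        ratFuncDeriv_div _ _ (mul_ne_zero hq hs), ratFuncDeriv_div _ _ hq, ratFuncDeriv_div _ _ hs]
      simp only [Polynomial.derivative_mul, map_mul, map_add]
      field_simp
      ring

/-- `ℂ(z)` as a differential field with the derivation `d/dz`. -/
instance instDifferentialRatFunc : Differential (RatFunc ℂ) :=
  differentialOfLeibniz ratFuncDeriv ratFuncDeriv_add ratFuncDeriv_mul

/-! ### Constants, and the differential field generated by an element -/

/-- The constants of the differential field `E` are exactly the complex numbers. -/
def ConstantsAreComplex (E : Type*) [Field E] [Algebra ℂ E] [Differential E] : Prop :=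
  ∀ f : E, f′ = 0 ↔ f ∈ (algebraMap ℂ E).range

/-- `ℂ⟨θ⟩`: the smallest differential subfield of `K` containing `ℂ` and `θ`. -/
def diffAdjoin {K : Type*} [Field K] [Algebra ℂ K] [Differential K] (θ : K) :
    IntermediateField ℂ K :=
  sInf {F : IntermediateField ℂ K | θ ∈ F ∧ ∀ f ∈ F, f′ ∈ F}

section diffAdjoin

variable {K : Type*} [Field K] [Algebra ℂ K] [Differential K] (θ : K)

theorem mem_diffAdjoin_iff {f : K} :
    f ∈ diffAdjoin θ ↔
      ∀ F : IntermediateField ℂ K, θ ∈ F → (∀ g ∈ F, g′ ∈ F) → f ∈ F := by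
  rw [diffAdjoin, ← SetLike.mem_coe, IntermediateField.coe_sInf]
  simp

theorem self_mem_diffAdjoin : θ ∈ diffAdjoin θ :=
  (mem_diffAdjoin_iff θ).2 fun _ h _ => h

theorem deriv_mem_diffAdjoin {f : K} (hf : f ∈ diffAdjoin θ) : f′ ∈ diffAdjoin θ :=
  (mem_diffAdjoin_iff θ).2 fun F h1 h2 => h2 f ((mem_diffAdjoin_iff θ).1 hf F h1 h2)

/-- `θ` as an element of `ℂ⟨θ⟩`. -/
def diffAdjoinGen : diffAdjoin θ := ⟨θ, self_mem_diffAdjoin θ⟩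

/-- `ℂ⟨θ⟩` with the derivation of `K`. -/
instance instDifferentialDiffAdjoin : Differential (diffAdjoin θ) :=
  differentialOfLeibniz (fun f => ⟨(f : K)′, deriv_mem_diffAdjoin θ f.2⟩)
    (fun f g => Subtype.ext (by simp)) (fun f g => Subtype.ext (by simp))

end diffAdjoin

/-! ### Second order linear equations, Picard-Vessiot extensions and their groups

`F` is a differential field containing `ℂ`, and `E` is a differential field extension of `F`. -/

section PicardVessiot

variable {F : Type*} [Field F] (E : Type*) [Field E] [Algebra ℂ E] [Algebra F E] [Differential E]

/-- The operator `∂² + a ∂ + b` with coefficients in `F`, applied to an element of `E`. -/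
def secondOrderOp (a b : F) (y : E) : E :=
  y′′ + algebraMap F E a * y′ + algebraMap F E b * y

/-- `(y 0, y 1)` is a basis over `ℂ` of the space of solutions in `E` of `y'' + a y' + b y = 0`. -/
structure IsFundamentalSystem (a b : F) (y : Fin 2 → E) : Prop where
  solution : ∀ i, secondOrderOp E a b (y i) = 0
  linearIndependent : LinearIndependent ℂ y
  mem_span : ∀ f : E, secondOrderOp E a b f = 0 → f ∈ Submodule.span ℂ (Set.range y)

/-- `E` is a Picard-Vessiot extension of `F` for `y'' + a y' + b y = 0`: its constants are the
complex numbers, and it is generated by a fundamental system of solutions and its derivatives. -/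
structure IsPicardVessiot (a b : F) : Prop where
  constants : ConstantsAreComplex E
  generated : ∃ y : Fin 2 → E, IsFundamentalSystem E a b y ∧
    IntermediateField.adjoin F (Set.range y ∪ Set.range fun i => (y i)′) = ⊤

variable (F)

/-- The differential Galois group: the automorphisms of `E` over `F` commuting with the
derivation. -/
def DGal : Subgroup (E ≃ₐ[F] E) where
  carrier := {σ | ∀ f : E, σ f′ = (σ f)′}
  one_mem' := fun _ => rfl
  mul_mem' := fun {σ τ} hσ hτ f => by
    simp only [Set.mem_ofPred_eq] at hσ hτ
    rw [AlgEquiv.mul_apply, AlgEquiv.mul_apply, hτ, hσ]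
  inv_mem' := fun {σ} hσ f => by
    simp only [Set.mem_ofPred_eq] at hσ
    apply σ.injective
    rw [hσ]
    simp [AlgEquiv.aut_inv]

variable {E} [Algebra ℂ F] [IsScalarTower ℂ F E]

/-- The differential Galois group as a group of matrices, in terms of `y = (y 0, y 1)`:
the matrices `A` with `(σ (y 0), σ (y 1)) = (y 0, y 1) A` for some `σ` in the group. -/
def DGalMatrix (y : Fin 2 → E) : Subgroup (GL (Fin 2) ℂ) where
  carrier := {A | ∃ σ ∈ DGal F E, ∀ j, σ (y j) = ∑ i, (A : Matrix (Fin 2) (Fin 2) ℂ) i j • y i}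
  one_mem' := ⟨1, one_mem _, fun j => by simp [Matrix.one_apply, ite_smul]⟩
  mul_mem' := by
    rintro A B ⟨σ, hσ, hA⟩ ⟨τ, hτ, hB⟩
    refine ⟨σ * τ, mul_mem hσ hτ, fun j => ?_⟩
    have h : ∀ (c : ℂ) (f : E), σ (c • f) = c • σ f := (σ.restrictScalars ℂ).toLinearEquiv.map_smul
    rw [AlgEquiv.mul_apply, hB]
    simp only [map_add, h, hA, Fin.sum_univ_two, Units.val_mul, Matrix.mul_apply]
    module
  inv_mem' := by
    rintro A ⟨σ, hσ, hA⟩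
    refine ⟨σ⁻¹, inv_mem hσ, fun j => ?_⟩
    have h : ∀ (c : ℂ) (f : E), σ (c • f) = c • σ f := (σ.restrictScalars ℂ).toLinearEquiv.map_smul
    apply σ.injective
    have h1 : ∀ k, ∑ i, (A : Matrix (Fin 2) (Fin 2) ℂ) k i *
        ((A⁻¹ : GL (Fin 2) ℂ) : Matrix (Fin 2) (Fin 2) ℂ) i j =
        (1 : Matrix (Fin 2) (Fin 2) ℂ) k j := fun k => by
      rw [← Matrix.mul_apply, ← Units.val_mul, mul_inv_cancel, Units.val_one]
    have h2 : σ (σ⁻¹ (y j)) = y j := by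
      rw [← AlgEquiv.mul_apply, mul_inv_cancel, AlgEquiv.one_apply]
    have h3 : y j = ∑ k, (1 : Matrix (Fin 2) (Fin 2) ℂ) k j • y k := by
      simp [Matrix.one_apply, ite_smul]
    rw [h2, h3]
    simp only [← h1, map_add, h, hA, Fin.sum_univ_two]
    module

end PicardVessiot

/-! ### The identity component of a group of matrices -/

/-- The value at `A` of a polynomial in the entries of `A` (the variables `some (i, j)`) and in the
inverse of its determinant (the variable `none`). -/
def evalGL (p : MvPolynomial (Option (Fin 2 × Fin 2)) ℂ) (A : GL (Fin 2) ℂ) : ℂ :=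
  MvPolynomial.eval
    (fun v => v.elim (A : Matrix (Fin 2) (Fin 2) ℂ).det⁻¹
      fun ij => (A : Matrix (Fin 2) (Fin 2) ℂ) ij.1 ij.2) p

/-- The Zariski topology on `GL(2, ℂ)`: the closed sets are the sets defined by polynomial
equations in the entries and in the inverse of the determinant. -/
@[reducible]
def zariskiGL : TopologicalSpace (GL (Fin 2) ℂ) :=
  TopologicalSpace.ofClosed
    {Z | ∃ S : Set (MvPolynomial (Option (Fin 2 × Fin 2)) ℂ), Z = {A | ∀ p ∈ S, evalGL p A = 0}}
    ⟨{1}, by ext; simp [evalGL]⟩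
    (by
      intro T hT
      refine ⟨{p | ∃ Z ∈ T, ∀ A ∈ Z, evalGL p A = 0}, ?_⟩
      ext A
      simp only [Set.mem_sInter, Set.mem_ofPred_eq]
      constructor
      · rintro h p ⟨Z, hZ, hp⟩
        exact hp A (h Z hZ)
      · intro h Z hZ
        obtain ⟨S, hS⟩ := hT hZ
        rw [hS]
        intro p hp
        refine h p ⟨Z, hZ, fun B hB => ?_⟩
        rw [hS] at hB
        exact hB p hp)
    (by
      rintro _ ⟨S, rfl⟩ _ ⟨T, rfl⟩
      refine ⟨{r | ∃ p ∈ S, ∃ q ∈ T, r = p * q}, ?_⟩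
      ext A
      simp only [Set.mem_union, Set.mem_ofPred_eq]
      constructor
      · rintro (h | h) _ ⟨p, hp, q, hq, rfl⟩
        · have := h p hp
          simp only [evalGL] at this ⊢
          rw [map_mul, this, zero_mul]
        · have := h q hq
          simp only [evalGL] at this ⊢
          rw [map_mul, this, mul_zero]
      · intro h
        by_contra! hcon
        obtain ⟨⟨p, hp, hp0⟩, ⟨q, hq, hq0⟩⟩ := hcon
        have := h _ ⟨p, hp, q, hq, rfl⟩
        simp only [evalGL] at this hp0 hq0
        rw [map_mul] at this
        exact (mul_ne_zero hp0 hq0) this)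

/-- The identity component `G⁰`: the connected component of the identity in `G`, for the topology
induced on `G` by the Zariski topology. -/
def identityComponent (G : Subgroup (GL (Fin 2) ℂ)) : Set (GL (Fin 2) ℂ) :=
  @connectedComponentIn (GL (Fin 2) ℂ) zariskiGL (G : Set (GL (Fin 2) ℂ)) 1

/-! ### The change of variable -/

/-- `φ` is the substitution `y ↦ y ∘ t`: it is an embedding over `ℂ` of the differential extension
`E` of `(ℂ(z), d/dz)` into the differential field `M` which sends `z` to `t` and satisfies the
chain rule. -/
structure IsSubstitution {E M : Type*} [Field E] [Algebra ℂ E] [Algebra (RatFunc ℂ) E]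
    [Differential E] [Field M] [Algebra ℂ M] [Differential M] (t : M) (φ : E →ₐ[ℂ] M) : Prop where
  map_z : φ (algebraMap (RatFunc ℂ) E RatFunc.X) = t
  chain_rule : ∀ f : E, (φ f)′ = t′ * φ f′

end

/-!
The proof compares algebraic relations. A fundamental system `y` of `y'' + a y' + b y = 0` is
recorded in its Wronskian matrix `Y`, which solves `∂Y = N Y` for the companion matrix `N`, and
the ideal of the polynomial relations over the base field between the entries of `Y`
(`relationIdeal`) determines the field that they generate.

*The Galois group.* An invertible constant matrix `A` lies in the Galois group if and only if
every relation of `Y` is a relation of `Y A` (`mem_DGalMatrix_iff`). It is enough to ask for an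
inclusion of ideals, because polynomial rings are Noetherian and a substitution automorphism
cannot enlarge an ideal strictly. As a condition on `A` this is polynomial, so the Galois group is
Zariski closed (`isClosed_preserves_relationIdeal`).

*Existence of the substitution.* On `L₀` the derivation `(1 / θ') ∂` extends `d/dz` along `z ↦ θ`,
and the solutions of the transformed equation become solutions of the original one. So what is
needed is that a Picard-Vessiot extension `L` of `F` embeds into every extension `M` of `F`
without new constants that has a fundamental matrix `R`. In the differential ring `M ⊗ L` over `F`
the matrix `R⁻¹ Y` is constant, and constants are linearly disjoint from `M` over `ℂ`
(`lift_injective_of_constants`). By the Nullstellensatz the algebra generated by its entries and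
those of its inverse has a complex point; specializing there gives a constant matrix `C` such that
the relations of `Y` hold for `R C` (`exists_relationIdeal_le`). Exchanging `L` and `M`, and using
the Noetherian property once more, the relations of `Y` and `R C` are the same.

*The identity components.* Let `G` be the group of the original equation and `H` that of the
transformed one, both as matrix groups. The Wronskian matrices of the two systems differ only by a
diagonal factor over `K₀`, which is harmless. A matrix that preserves the relations over `K₀`
preserves those over `ℂ(θ)`, so `H ≤ G`. If `K₀` is algebraic over `ℂ(θ)`, then `K₀ = ℂ(θ, θ')` is
a finite extension of it (`finiteDimensional_diffAdjoin`). Each element of `G` extends to an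
embedding of `L₀` into an algebraic closure, and two elements whose extensions agree on `K₀` lie
in the same coset of `H`. Since `K₀` has only finitely many embeddings over `ℂ(θ)`, the closed
subgroup `H` has finite index in `G`, so it contains the identity component of `G`
(`connectedComponentIn_one_eq_of_finite`).
-/

noncomputable section

/-! ### Ideals of algebraic relations -/

section RelationIdeal

variable {n : Type*}

/-- The ideal of the polynomial relations with coefficients in `F` between the entries of the
matrix `Y`. -/
def relationIdeal (F : Type*) {E : Type*} [Field F] [CommRing E] [Algebra F E]
    (Y : Matrix n n E) : Ideal (MvPolynomial (n × n) F) :=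
  RingHom.ker (MvPolynomial.aeval (R := F) fun k : n × n => Y k.1 k.2)

theorem mem_relationIdeal {F E : Type*} [Field F] [CommRing E] [Algebra F E] {Y : Matrix n n E}
    {p : MvPolynomial (n × n) F} :
    p ∈ relationIdeal F Y ↔ MvPolynomial.aeval (fun k : n × n => Y k.1 k.2) p = 0 :=
  Iff.rfl

theorem relationIdeal_map {F E M : Type*} [Field F] [CommRing E] [Algebra F E] [CommRing M]
    [Algebra F M] (φ : E →ₐ[F] M) (hφ : Function.Injective φ) (Y : Matrix n n E) :
    relationIdeal F (Y.map φ) = relationIdeal F Y := by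
  ext p
  rw [mem_relationIdeal, mem_relationIdeal, ← map_eq_zero_iff φ hφ, ← AlgHom.comp_apply,
    MvPolynomial.comp_aeval]
  rfl

theorem relationIdeal_eq_comap {F K E : Type*} [Field F] [Field K] [CommRing E] [Algebra F K]
    [Algebra F E] [Algebra K E] [IsScalarTower F K E] (Y : Matrix n n E) :
    relationIdeal F Y = (relationIdeal K Y).comap (MvPolynomial.map (algebraMap F K)) := by
  ext p
  rw [Ideal.mem_comap, mem_relationIdeal, mem_relationIdeal, MvPolynomial.aeval_map_algebraMap]

variable [Fintype n]

/-- The substitution `Y ↦ Y A` in the polynomials in the entries of a matrix `Y`. -/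
def substRight {F : Type*} [Field F] (A : Matrix n n F) :
    MvPolynomial (n × n) F →ₐ[F] MvPolynomial (n × n) F :=
  MvPolynomial.aeval fun k => ∑ j, MvPolynomial.X (k.1, j) * MvPolynomial.C (A j k.2)

/-- The substitution `Y ↦ B Y` in the polynomials in the entries of a matrix `Y`. -/
def substLeft {F : Type*} [Field F] (B : Matrix n n F) :
    MvPolynomial (n × n) F →ₐ[F] MvPolynomial (n × n) F :=
  MvPolynomial.aeval fun k => ∑ j, MvPolynomial.C (B k.1 j) * MvPolynomial.X (j, k.2)

variable {F E : Type*} [Field F] [CommRing E] [Algebra F E]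

theorem aeval_substRight (A : Matrix n n F) (Y : Matrix n n E) (p : MvPolynomial (n × n) F) :
    MvPolynomial.aeval (fun k : n × n => Y k.1 k.2) (substRight A p) =
      MvPolynomial.aeval (fun k : n × n => (Y * A.map (algebraMap F E)) k.1 k.2) p := by
  rw [substRight, ← AlgHom.comp_apply, MvPolynomial.comp_aeval]
  congr 2
  ext k
  simp [Matrix.mul_apply]

theorem aeval_substLeft (B : Matrix n n F) (Y : Matrix n n E) (p : MvPolynomial (n × n) F) :
    MvPolynomial.aeval (fun k : n × n => Y k.1 k.2) (substLeft B p) =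
      MvPolynomial.aeval (fun k : n × n => (B.map (algebraMap F E) * Y) k.1 k.2) p := by
  rw [substLeft, ← AlgHom.comp_apply, MvPolynomial.comp_aeval]
  congr 2
  ext k
  simp [Matrix.mul_apply]

theorem comap_substRight (A : Matrix n n F) (Y : Matrix n n E) :
    (relationIdeal F Y).comap (substRight A) = relationIdeal F (Y * A.map (algebraMap F E)) := by
  ext p
  rw [Ideal.mem_comap, mem_relationIdeal, mem_relationIdeal, aeval_substRight]

theorem comap_substLeft (B : Matrix n n F) (Y : Matrix n n E) :
    (relationIdeal F Y).comap (substLeft B) = relationIdeal F (B.map (algebraMap F E) * Y) := by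
  ext p
  rw [Ideal.mem_comap, mem_relationIdeal, mem_relationIdeal, aeval_substLeft]

theorem substRight_surjective [DecidableEq n] (A : GL n F) :
    Function.Surjective (substRight (A : Matrix n n F)) := by
  rw [← AlgHom.range_eq_top, eq_top_iff, ← MvPolynomial.adjoin_range_X, Algebra.adjoin_le_iff]
  rintro _ ⟨k, rfl⟩
  refine ⟨substRight ((A⁻¹ : GL n F) : Matrix n n F) (MvPolynomial.X k), ?_⟩
  have h1 : (A : Matrix n n F) * ((A⁻¹ : GL n F) : Matrix n n F) = 1 := by
    rw [← Units.val_mul, mul_inv_cancel, Units.val_one]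
  have h2 := fun i => congrFun (congrFun h1 i) k.2
  simp only [Matrix.mul_apply] at h2
  change substRight _ (substRight _ _) = _
  have h3 : ∀ (B : Matrix n n F) (l : n × n), substRight B (MvPolynomial.X l) =
      ∑ j, MvPolynomial.X (l.1, j) * MvPolynomial.C (B j l.2) := fun B l => by simp [substRight]
  rw [h3]
  simp only [map_sum, map_mul, h3, MvPolynomial.algHom_C, MvPolynomial.algebraMap_eq,
    Finset.sum_mul]
  rw [Finset.sum_comm]
  simp only [mul_assoc, ← MvPolynomial.C_mul, ← Finset.mul_sum, ← map_sum, h2,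
    Matrix.one_apply]
  simp [apply_ite MvPolynomial.C]

/-- A surjective ring endomorphism of a Noetherian ring cannot enlarge an ideal strictly by
pull-back. -/
theorem Ideal.comap_eq_of_le_of_surjective {R : Type*} [CommRing R] [IsNoetherianRing R]
    (f : R →+* R) (hf : Function.Surjective f) {I : Ideal R} (h : I ≤ I.comap f) :
    I.comap f = I := by
  have hmono : Monotone fun k => (Ideal.comap f)^[k] I := by
    refine monotone_nat_of_le_succ fun k => ?_
    rw [Function.iterate_succ_apply]
    exact (Monotone.iterate (fun _ _ h => Ideal.comap_mono h) k) h
  obtain ⟨k, hk⟩ := monotone_stabilizes_iff_noetherian.2 ‹IsNoetherianRing R› ⟨_, hmono⟩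
  have h1 := hk (k + 1) (Nat.le_succ k)
  simp only [OrderHom.coe_mk] at h1
  rw [Function.iterate_succ_apply] at h1
  exact ((Ideal.comap_injective_of_surjective f hf).iterate k h1).symm

theorem relationIdeal_mul_eq_of_le [DecidableEq n] (A : GL n F) (Y : Matrix n n E)
    (h : relationIdeal F Y ≤ relationIdeal F (Y * (A : Matrix n n F).map (algebraMap F E))) :
    relationIdeal F (Y * (A : Matrix n n F).map (algebraMap F E)) = relationIdeal F Y := by
  rw [← comap_substRight] at h ⊢
  exact Ideal.comap_eq_of_le_of_surjective (substRight (A : Matrix n n F)).toRingHom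
    (substRight_surjective A) h

theorem relationIdeal_mul_left_mono (B : Matrix n n F) {Y : Matrix n n E} {M : Type*} [CommRing M]
    [Algebra F M] {R : Matrix n n M} (h : relationIdeal F Y ≤ relationIdeal F R) :
    relationIdeal F (B.map (algebraMap F E) * Y) ≤
      relationIdeal F (B.map (algebraMap F M) * R) := by
  rw [← comap_substLeft, ← comap_substLeft]
  exact Ideal.comap_mono h

section Constant

variable {k : Type*} [Field k] [Algebra k F] [Algebra k E] [IsScalarTower k F E]

theorem GeneralLinearGroup.map_algebraMap_eq [DecidableEq n] (A : GL n k) :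
    (A : Matrix n n k).map (algebraMap k E) =
      ((Matrix.GeneralLinearGroup.map (algebraMap k F) A : GL n F) : Matrix n n F).map
        (algebraMap F E) := by
  ext i j
  simp [IsScalarTower.algebraMap_apply k F E]

theorem relationIdeal_mul_mono {M : Type*} [CommRing M] [Algebra F M] [Algebra k M]
    [IsScalarTower k F M] [DecidableEq n] (A : GL n k) {Y : Matrix n n E} {R : Matrix n n M}
    (h : relationIdeal F Y ≤ relationIdeal F R) :
    relationIdeal F (Y * (A : Matrix n n k).map (algebraMap k E)) ≤
      relationIdeal F (R * (A : Matrix n n k).map (algebraMap k M)) := by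
  rw [GeneralLinearGroup.map_algebraMap_eq (F := F) (E := E),
    GeneralLinearGroup.map_algebraMap_eq (F := F) (E := M), ← comap_substRight, ← comap_substRight]
  exact Ideal.comap_mono h

/-- If right multiplication by an invertible matrix of constants preserves the relations, then it
creates no new ones. -/
theorem relationIdeal_mul_constant_eq_of_le [DecidableEq n] (A : GL n k) (Y : Matrix n n E)
    (h : relationIdeal F Y ≤ relationIdeal F (Y * (A : Matrix n n k).map (algebraMap k E))) :
    relationIdeal F (Y * (A : Matrix n n k).map (algebraMap k E)) = relationIdeal F Y := by
  rw [GeneralLinearGroup.map_algebraMap_eq (F := F) (E := E)] at h ⊢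
  exact relationIdeal_mul_eq_of_le _ Y h

end Constant

end RelationIdeal

/-! ### Embeddings determined by relations -/

section Extension

open IntermediateField.algebraAdjoinAdjoin in
/-- A field extension generated by a family `y` is determined by the relations of `y`: it embeds
into every extension that contains a family with the same relations. -/
theorem exists_algHom_of_ker_aeval_eq {F E M ι : Type*} [Field F] [Field E] [Field M] [Algebra F E]
    [Algebra F M] (y : ι → E) (r : ι → M) (hy : IntermediateField.adjoin F (Set.range y) = ⊤)
    (h : RingHom.ker (MvPolynomial.aeval (R := F) y) = RingHom.ker (MvPolynomial.aeval (R := F) r)) :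
    ∃ φ : E →ₐ[F] M, ∀ i, φ (y i) = r i := by
  let f := MvPolynomial.aeval (R := F) y
  let g := MvPolynomial.aeval (R := F) r
  let e : (MvPolynomial ι F ⧸ RingHom.ker f) ≃ₐ[F] Algebra.adjoin F (Set.range y) :=
    (Ideal.quotientKerAlgEquivOfSurjective f.rangeRestrict_surjective |>.symm |>.trans
      (Ideal.quotientEquivAlgOfEq F (by ext; simp [f, RingHom.mem_ker, Subtype.ext_iff]))).symm.trans
      (Subalgebra.equivOfEq _ _ (Algebra.adjoin_range_eq_range_aeval F y).symm)
  let g' : (MvPolynomial ι F ⧸ RingHom.ker f) →ₐ[F] M :=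
    Ideal.Quotient.liftₐ _ g fun p hp => by rw [h] at hp; exact hp
  have hg' : Function.Injective g' := by
    rw [injective_iff_map_eq_zero]
    intro x
    obtain ⟨p, rfl⟩ := Ideal.Quotient.mk_surjective x
    intro hp
    rw [Ideal.Quotient.eq_zero_iff_mem, h]
    exact hp
  let k : Algebra.adjoin F (Set.range y) →ₐ[F] M := g'.comp e.symm.toAlgHom
  have hk : Function.Injective k := hg'.comp e.symm.injective
  let l : IntermediateField.adjoin F (Set.range y) →ₐ[F] M := IsFractionRing.liftAlgHom hk
  refine ⟨l.comp ((IntermediateField.equivOfEq hy).trans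
    IntermediateField.topEquiv).symm.toAlgHom, fun i => ?_⟩
  have h1 : ((IntermediateField.equivOfEq hy).trans IntermediateField.topEquiv).symm (y i) =
      algebraMap (Algebra.adjoin F (Set.range y)) _ ⟨y i, Algebra.subset_adjoin ⟨i, rfl⟩⟩ := rfl
  have h2 : e (Ideal.Quotient.mk _ (MvPolynomial.X i)) =
      ⟨y i, Algebra.subset_adjoin ⟨i, rfl⟩⟩ := by
    apply Subtype.ext
    change f (MvPolynomial.X i) = y i
    simp [f]
  change l _ = _
  erw [h1]
  rw [show l _ = k _ from IsFractionRing.lift_algebraMap hk _]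
  change g' (e.symm _) = _
  rw [← h2, e.symm_apply_apply]
  change g (MvPolynomial.X i) = _
  simp [g]

end Extension

/-! ### Tensor products of differential rings -/

section TensorProduct

open TensorProduct

/-- The derivation `d ⊗ 1 + 1 ⊗ d` of the tensor product of two differential extensions of a
differential ring `F`. It is only additive, because the derivation of `F` need not vanish. -/
def tensorDerivation {F M L : Type*} [CommRing F] [CommRing M] [CommRing L] [Algebra F M]
    [Algebra F L] (dF : Derivation ℤ F F) (dM : Derivation ℤ M M) (dL : Derivation ℤ L L)
    (hM : ∀ f, dM (algebraMap F M f) = algebraMap F M (dF f))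
    (hL : ∀ f, dL (algebraMap F L f) = algebraMap F L (dF f)) :
    Derivation ℤ (M ⊗[F] L) (M ⊗[F] L) :=
  let D : M ⊗[F] L →+ M ⊗[F] L := TensorProduct.liftAddHom
    (AddMonoidHom.mk' (fun m => AddMonoidHom.mk' (fun l => dM m ⊗ₜ l + m ⊗ₜ dL l)
      fun a b => by simp only [map_add, TensorProduct.tmul_add]; abel)
      fun a b => by
        ext l
        simp only [map_add, TensorProduct.add_tmul, AddMonoidHom.mk'_apply, AddMonoidHom.add_apply]
        abel)
    (fun f m l => by
      have h1 : dM (f • m) = f • dM m + dF f • m := by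
        rw [Algebra.smul_def, Derivation.leibniz, hM, smul_eq_mul, smul_eq_mul, mul_comm m,
          Algebra.smul_def, Algebra.smul_def]
      have h2 : dL (f • l) = f • dL l + dF f • l := by
        rw [Algebra.smul_def, Derivation.leibniz, hL, smul_eq_mul, smul_eq_mul, mul_comm l,
          Algebra.smul_def, Algebra.smul_def]
      simp only [AddMonoidHom.mk'_apply, h1, h2, TensorProduct.add_tmul, TensorProduct.tmul_add,
        TensorProduct.smul_tmul]
      abel)
  Derivation.mk' D.toIntLinearMap fun x y => by
    change D (x * y) = x * D y + y * D x
    have hD : ∀ m l, D (m ⊗ₜ l) = dM m ⊗ₜ l + m ⊗ₜ dL l := fun _ _ => rfl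
    induction x with
    | zero => simp
    | add a b ha hb => rw [add_mul, map_add, ha, hb, map_add]; ring
    | tmul m l =>
      induction y with
      | zero => simp
      | add a b ha hb => rw [mul_add, map_add, ha, hb, map_add]; ring
      | tmul m' l' =>
        rw [Algebra.TensorProduct.tmul_mul_tmul, hD, hD, hD]
        simp only [Derivation.leibniz, smul_eq_mul, mul_add, TensorProduct.add_tmul,
          TensorProduct.tmul_add, Algebra.TensorProduct.tmul_mul_tmul]
        rw [mul_comm m' m, mul_comm l' l, mul_comm m' (dM m), mul_comm l' (dL l)]
        abel

theorem tensorDerivation_tmul {F M L : Type*} [CommRing F] [CommRing M] [CommRing L] [Algebra F M]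
    [Algebra F L] (dF : Derivation ℤ F F) (dM : Derivation ℤ M M) (dL : Derivation ℤ L L)
    (hM : ∀ f, dM (algebraMap F M f) = algebraMap F M (dF f))
    (hL : ∀ f, dL (algebraMap F L f) = algebraMap F L (dF f)) (m : M) (l : L) :
    tensorDerivation dF dM dL hM hL (m ⊗ₜ l) = dM m ⊗ₜ l + m ⊗ₜ dL l :=
  rfl

end TensorProduct

/-! ### Linear disjointness of constants -/

section Constants

variable {k M B : Type*} [Field k] [Field M] [CommRing B] [Algebra k M] [Algebra M B] [Algebra k B]
  [IsScalarTower k M B]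

/-- Constants of a differential algebra over a differential field `M` that are independent over
the constants `k` of `M` are independent over `M`. -/
theorem linearIndependent_of_constants (dM : Derivation ℤ M M) (dB : Derivation ℤ B B)
    (hB : ∀ m, dB (algebraMap M B m) = algebraMap M B (dM m))
    (hk : ∀ m, dM m = 0 → m ∈ (algebraMap k M).range) {ι : Type*} {v : ι → B}
    (hv : ∀ i, dB (v i) = 0) (hind : LinearIndependent k v) : LinearIndependent M v := by
  classical
  have key : ∀ (s : Finset ι) (l : ι → M), ∑ i ∈ s, l i • v i = 0 → ∀ i ∈ s, l i = 0 := by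
    intro s
    induction s using Finset.induction_on with
    | empty => simp
    | insert a s ha ih =>
      intro l hl
      rw [Finset.sum_insert ha] at hl
      by_cases h0 : l a = 0
      · rw [h0, zero_smul, zero_add] at hl
        intro i hi
        rcases Finset.mem_insert.1 hi with h | h
        · rw [h, h0]
        · exact ih l hl i h
      · exfalso
        -- after normalizing the coefficient of `v a` to `1`, differentiation shortens the relation
        have h1 : v a + ∑ i ∈ s, ((l a)⁻¹ * l i) • v i = 0 := by
          have := congrArg ((l a)⁻¹ • ·) hl
          simpa [smul_add, smul_smul, h0, Finset.smul_sum] using this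
        have h2 : ∑ i ∈ s, (dM ((l a)⁻¹ * l i)) • v i = 0 := by
          have := congrArg dB h1
          have hd : ∀ m i, dB (m • v i) = dM m • v i := fun m i => by
            rw [Algebra.smul_def, Derivation.leibniz, hv, hB, smul_zero, zero_add, smul_eq_mul,
              Algebra.smul_def, mul_comm]
          simpa only [map_add, map_sum, hd, hv, zero_add, map_zero] using this
        have h3 := ih _ h2
        choose! c hc using fun i hi => hk _ (h3 i hi)
        have h4 : ∑ i ∈ insert a s, (if i = a then 1 else c i) • v i = 0 := by
          rw [Finset.sum_insert ha, if_pos rfl, one_smul, ← h1]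
          congr 1
          refine Finset.sum_congr rfl fun i hi => ?_
          rw [if_neg (ne_of_mem_of_not_mem hi ha), ← hc i hi, algebraMap_smul]
        have h5 := linearIndependent_iff'.1 hind _ _ h4 a (Finset.mem_insert_self a s)
        simp at h5
  exact linearIndependent_iff'.2 key

open TensorProduct

/-- The field `M` and the constants of a differential algebra over `M` are linearly disjoint over
the constants of `M`. -/
theorem lift_injective_of_constants (dM : Derivation ℤ M M) (dB : Derivation ℤ B B)
    (hB : ∀ m, dB (algebraMap M B m) = algebraMap M B (dM m))
    (hk : ∀ m, dM m = 0 → m ∈ (algebraMap k M).range) (T : Subalgebra k B)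
    (hT : ∀ t ∈ T, dB t = 0) :
    Function.Injective
      (Algebra.TensorProduct.lift (Algebra.ofId M B) T.val fun _ _ => Commute.all _ _) := by
  set μ := Algebra.TensorProduct.lift (Algebra.ofId M B) T.val fun _ _ => Commute.all _ _
  let b := Module.Free.chooseBasis k T
  have hb : LinearIndependent M fun i => (b i : B) :=
    linearIndependent_of_constants dM dB hB hk (fun i => hT _ (b i).2)
      (b.linearIndependent.map' T.val.toLinearMap
        (LinearMap.ker_eq_bot.2 Subtype.val_injective))
  rw [injective_iff_map_eq_zero]
  intro x hx
  have h1 : Finsupp.linearCombination M (fun i => (b i : B)) ((b.baseChange M).repr x) = 0 := by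
    rw [← hx]
    conv_rhs => rw [← (b.baseChange M).linearCombination_repr x]
    rw [Finsupp.linearCombination_apply, Finsupp.linearCombination_apply, Finsupp.sum, Finsupp.sum,
      map_sum]
    refine Finset.sum_congr rfl fun i _ => ?_
    simp [μ]
  have h2 := linearIndependent_iff.1 hb _ h1
  simpa using h2

end Constants

/-! ### Rational points -/

section Nullstellensatz

/-- Hilbert's Nullstellensatz: a nonzero finitely generated algebra over an algebraically closed
field has a rational point. -/
theorem nonempty_algHom_of_finiteType (k T : Type*) [Field k] [IsAlgClosed k] [CommRing T]
    [Nontrivial T] [Algebra k T] [Algebra.FiniteType k T] : Nonempty (T →ₐ[k] k) := by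
  obtain ⟨m, hm⟩ := Ideal.exists_maximal T
  let := Ideal.Quotient.field m
  have := finite_of_finite_type_of_isJacobsonRing k (T ⧸ m)
  exact ⟨(IsAlgClosed.lift : (T ⧸ m) →ₐ[k] k).comp (Ideal.Quotient.mkₐ k m)⟩

end Nullstellensatz

/-! ### Fundamental matrices in two differential extensions -/

section Uniqueness

open TensorProduct

theorem Matrix.map_derivation_mul {n B : Type*} [Fintype n] [CommRing B] (d : Derivation ℤ B B)
    (X Y : Matrix n n B) : (X * Y).map d = X.map d * Y + X * Y.map d := by
  ext i j
  simp [Matrix.mul_apply, Finset.sum_add_distrib, Derivation.leibniz, mul_comm, add_comm]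

/-- If `Y` and `R` are fundamental matrices of `∂Y = N Y`, then `R⁻¹ Y` is constant. -/
theorem Matrix.map_derivation_inv_mul_eq_zero {n B : Type*} [Fintype n] [DecidableEq n] [CommRing B]
    (d : Derivation ℤ B B) {N R Y : Matrix n n B} (hR : IsUnit R.det) (dR : R.map d = N * R)
    (dY : Y.map d = N * Y) : (R⁻¹ * Y).map d = 0 := by
  have h1 := Matrix.map_derivation_mul d R (R⁻¹ * Y)
  rw [← Matrix.mul_assoc, Matrix.mul_nonsing_inv _ hR, Matrix.one_mul, dY, dR, Matrix.mul_assoc,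
    ← Matrix.mul_assoc R, Matrix.mul_nonsing_inv _ hR, Matrix.one_mul, left_eq_add] at h1
  rw [← Matrix.one_mul ((R⁻¹ * Y).map d), ← Matrix.nonsing_inv_mul _ hR, Matrix.mul_assoc, h1,
    Matrix.mul_zero]

variable {n k F M L : Type*} [Fintype n] [DecidableEq n] [Field k] [IsAlgClosed k] [Field F]
  [Field M] [Field L] [Algebra k F] [Algebra k M] [Algebra F M] [IsScalarTower k F M] [Algebra F L]

/-- Let `Y` and `R` be fundamental matrices of the same linear differential system over `F`, in two
differential extensions `L` and `M` of `F`, where `M` has no constants outside the algebraically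
closed field `k`. Then every relation of `Y` over `F` is a relation of `R C`, for a suitable
constant matrix `C`. -/
theorem exists_relationIdeal_le (dF : Derivation ℤ F F) (dM : Derivation ℤ M M)
    (dL : Derivation ℤ L L) (hM : ∀ f, dM (algebraMap F M f) = algebraMap F M (dF f))
    (hL : ∀ f, dL (algebraMap F L f) = algebraMap F L (dF f))
    (hk0 : ∀ c, dM (algebraMap k M c) = 0)
    (hk : ∀ m, dM m = 0 → m ∈ (algebraMap k M).range) (N : Matrix n n F)
    {R : Matrix n n M} {Y : Matrix n n L} (hR : R.det ≠ 0) (hY : Y.det ≠ 0)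
    (dR : R.map dM = N.map (algebraMap F M) * R) (dY : Y.map dL = N.map (algebraMap F L) * Y) :
    ∃ C : GL n k, relationIdeal F Y ≤
      relationIdeal F (R * (C : Matrix n n k).map (algebraMap k M)) := by
  let B := M ⊗[F] L
  let dB : Derivation ℤ B B := tensorDerivation dF dM dL hM hL
  let iM : M →+* B := algebraMap M B
  let iL : L →ₐ[F] B := Algebra.TensorProduct.includeRight
  have hBM : ∀ m, dB (iM m) = iM (dM m) := fun m => by
    change dB (m ⊗ₜ 1) = dM m ⊗ₜ 1
    rw [tensorDerivation_tmul, Derivation.map_one_eq_zero, TensorProduct.tmul_zero, add_zero]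
  have hBL : ∀ l, dB (iL l) = iL (dL l) := fun l => by
    change dB (1 ⊗ₜ l) = 1 ⊗ₜ dL l
    rw [tensorDerivation_tmul, Derivation.map_one_eq_zero, TensorProduct.zero_tmul, zero_add]
  have hBF : ∀ f, iM (algebraMap F M f) = iL (algebraMap F L f) := fun f => by
    rw [iL.commutes]; rfl
  let RB : Matrix n n B := R.map iM
  let YB : Matrix n n B := Y.map iL
  let NB : Matrix n n B := (N.map (algebraMap F L)).map iL
  have hNB : NB = (N.map (algebraMap F M)).map iM := by
    ext i j; exact (hBF _).symm
  have hRB : IsUnit RB.det := by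
    have : RB.det = iM R.det := (RingHom.map_det iM R).symm
    rw [this]; exact (isUnit_iff_ne_zero.2 hR).map iM
  have hYB : IsUnit YB.det := by
    have : YB.det = iL Y.det := (AlgHom.map_det iL Y).symm
    rw [this]; exact (isUnit_iff_ne_zero.2 hY).map iL
  have dRB : RB.map dB = NB * RB := by
    rw [hNB, ← Matrix.map_mul, ← dR]
    ext i j; exact hBM _
  have dYB : YB.map dB = NB * YB := by
    rw [← Matrix.map_mul, ← dY]
    ext i j; exact hBL _
  -- the entries of the constant matrices `Z = R⁻¹ Y` and `W = Y⁻¹ R` generate an algebra of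
  -- constants; one of its points over `k` gives the matrix `C`
  let Z : Matrix n n B := RB⁻¹ * YB
  let W : Matrix n n B := YB⁻¹ * RB
  have hRZ : RB * Z = YB := by
    rw [← Matrix.mul_assoc, Matrix.mul_nonsing_inv _ hRB, Matrix.one_mul]
  have hZW : Z * W = 1 := by
    change RB⁻¹ * YB * (YB⁻¹ * RB) = 1
    rw [Matrix.mul_assoc, ← Matrix.mul_assoc YB, Matrix.mul_nonsing_inv _ hYB, Matrix.one_mul,
      Matrix.nonsing_inv_mul _ hRB]
  let T : Subalgebra k B := Algebra.adjoin k
    (Set.range (fun x : n × n => Z x.1 x.2) ∪ Set.range fun x : n × n => W x.1 x.2)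
  have hZT : ∀ i j, Z i j ∈ T := fun i j => Algebra.subset_adjoin (Or.inl ⟨(i, j), rfl⟩)
  have hWT : ∀ i j, W i j ∈ T := fun i j => Algebra.subset_adjoin (Or.inr ⟨(i, j), rfl⟩)
  have hT : ∀ t ∈ T, dB t = 0 := by
    intro t ht
    induction ht using Algebra.adjoin_induction with
    | mem x hx =>
      rcases hx with ⟨x, rfl⟩ | ⟨x, rfl⟩
      · exact congrFun (congrFun (Matrix.map_derivation_inv_mul_eq_zero dB hRB dRB dYB) x.1) x.2
      · exact congrFun (congrFun (Matrix.map_derivation_inv_mul_eq_zero dB hYB dYB dRB) x.1) x.2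
    | algebraMap c =>
      rw [IsScalarTower.algebraMap_apply k M B]
      exact (hBM _).trans (by rw [hk0, map_zero])
    | add x y _ _ hx hy => rw [map_add, hx, hy, add_zero]
    | mul x y _ _ hx hy => rw [Derivation.leibniz, hx, hy, smul_zero, smul_zero, add_zero]
  have : Algebra.FiniteType k T := Subalgebra.fg_iff_finiteType T |>.1
    (Subalgebra.fg_def.2 ⟨_, (Set.finite_range _).union (Set.finite_range _), rfl⟩)
  obtain ⟨χ⟩ := nonempty_algHom_of_finiteType k T
  let ZT : Matrix n n T := fun i j => ⟨Z i j, hZT i j⟩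
  let WT : Matrix n n T := fun i j => ⟨W i j, hWT i j⟩
  have hZWT : ZT * WT = 1 := by
    ext i j
    have := congrFun (congrFun hZW i) j
    rw [Matrix.mul_apply] at this ⊢
    simpa [Matrix.one_apply, apply_ite Subtype.val, ZT, WT] using this
  have hC : ZT.map χ * WT.map χ = 1 := by
    rw [← Matrix.map_mul, hZWT, Matrix.map_one _ (map_zero χ) (map_one χ)]
  refine ⟨⟨ZT.map χ, WT.map χ, hC, mul_eq_one_comm.1 hC⟩, fun p hp => ?_⟩
  let μ : M ⊗[k] T →ₐ[M] B :=
    Algebra.TensorProduct.lift (Algebra.ofId M B) T.val fun _ _ => Commute.all _ _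
  have hμ : Function.Injective μ := lift_injective_of_constants dM dB hBM hk T hT
  let ν : M ⊗[k] T →ₐ[M] M :=
    Algebra.TensorProduct.lift (AlgHom.id M M) ((Algebra.ofId k M).comp χ)
      fun _ _ => Commute.all _ _
  let U : Matrix n n (M ⊗[k] T) :=
    R.map (algebraMap M (M ⊗[k] T)) * ZT.map (Algebra.TensorProduct.includeRight (R := k) (A := M))
  have hμU : ∀ x : n × n, μ (U x.1 x.2) = iL (Y x.1 x.2) := fun x => by
    have : iL (Y x.1 x.2) = (RB * Z) x.1 x.2 := by rw [hRZ]; rfl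
    rw [this, Matrix.mul_apply]
    change μ (∑ j, _) = _
    rw [map_sum]
    refine Finset.sum_congr rfl fun j _ => ?_
    rw [map_mul]
    congr 1
    · exact μ.commutes _
    change μ (1 ⊗ₜ ZT j x.2) = Z j x.2
    simp [μ, ZT]
  have hνU : ∀ x : n × n, ν (U x.1 x.2) = (R * (ZT.map χ).map (algebraMap k M)) x.1 x.2 :=
    fun x => by
      rw [Matrix.mul_apply]
      change ν (∑ j, _) = _
      rw [map_sum]
      refine Finset.sum_congr rfl fun j _ => ?_
      simp [ν, Algebra.ofId_apply]
  rw [mem_relationIdeal] at hp ⊢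
  have h1 : MvPolynomial.aeval (fun x : n × n => U x.1 x.2) p = 0 := by
    apply hμ
    have h2 := congrArg iL hp
    rw [map_zero, ← AlgHom.comp_apply, MvPolynomial.comp_aeval] at h2
    rw [map_zero, ← AlgHom.restrictScalars_apply F μ, ← AlgHom.comp_apply, MvPolynomial.comp_aeval,
      ← h2]
    congr 2
    ext x
    exact hμU x
  have h3 := congrArg ν h1
  rw [map_zero, ← AlgHom.restrictScalars_apply F ν, ← AlgHom.comp_apply,
    MvPolynomial.comp_aeval] at h3
  rw [← h3]
  congr 2
  ext x
  exact (hνU x).symm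

/-- Two differential extensions of `F` without new constants, each with a fundamental matrix of the
same linear differential system: the relations of the two fundamental matrices over `F` agree, up to
a constant change of basis. -/
theorem exists_relationIdeal_eq [Algebra k L] [IsScalarTower k F L]
    (dF : Derivation ℤ F F) (dM : Derivation ℤ M M)
    (dL : Derivation ℤ L L) (hM : ∀ f, dM (algebraMap F M f) = algebraMap F M (dF f))
    (hL : ∀ f, dL (algebraMap F L f) = algebraMap F L (dF f))
    (hkM : ∀ m, dM m = 0 ↔ m ∈ (algebraMap k M).range)
    (hkL : ∀ l, dL l = 0 ↔ l ∈ (algebraMap k L).range) (N : Matrix n n F)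
    {R : Matrix n n M} {Y : Matrix n n L} (hR : R.det ≠ 0) (hY : Y.det ≠ 0)
    (dR : R.map dM = N.map (algebraMap F M) * R) (dY : Y.map dL = N.map (algebraMap F L) * Y) :
    ∃ C : GL n k, relationIdeal F Y =
      relationIdeal F (R * (C : Matrix n n k).map (algebraMap k M)) := by
  obtain ⟨C, hC⟩ := exists_relationIdeal_le dF dM dL hM hL (fun c => (hkM _).2 ⟨c, rfl⟩)
    (fun m => (hkM m).1) N hR hY dR dY
  obtain ⟨D, hD⟩ := exists_relationIdeal_le dF dL dM hL hM (fun c => (hkL _).2 ⟨c, rfl⟩)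
    (fun l => (hkL l).1) N hY hR dY dR
  refine ⟨C, le_antisymm hC ?_⟩
  -- `Y ↦ R C ↦ Y D C` preserves the relations, hence creates none
  have h1 : relationIdeal F (R * (C : Matrix n n k).map (algebraMap k M)) ≤
      relationIdeal F (Y * ((D * C : GL n k) : Matrix n n k).map (algebraMap k L)) := by
    rw [Units.val_mul, Matrix.map_mul, ← Matrix.mul_assoc]
    exact relationIdeal_mul_mono C hD
  exact h1.trans (relationIdeal_mul_constant_eq_of_le _ Y (hC.trans h1)).le

end Uniqueness

/-! ### Closed subgroups of finite index in the Zariski topology -/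

section Zariski

open scoped Topology

/-- A closed subgroup of finite index contains the identity component, so both groups have the same
identity component. The finiteness of the index is expressed by an invariant `c` with finitely many
values which separates the cosets. -/
theorem connectedComponentIn_one_eq_of_finite {Γ X : Type*} [Group Γ] [TopologicalSpace Γ]
    [Finite X] (hmul : ∀ g : Γ, Continuous (g * ·)) {H G : Subgroup Γ} (hle : H ≤ G)
    (hH : IsClosed (H : Set Γ)) (c : Γ → X)
    (hc : ∀ g ∈ G, ∀ h ∈ G, c g = c h → g⁻¹ * h ∈ H) :
    connectedComponentIn (H : Set Γ) 1 = connectedComponentIn (G : Set Γ) 1 := by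
  refine Set.Subset.antisymm (connectedComponentIn_mono _ hle) ?_
  have h1 : (1 : Γ) ∈ connectedComponentIn (G : Set Γ) 1 := mem_connectedComponentIn G.one_mem
  refine isPreconnected_connectedComponentIn.subset_connectedComponentIn h1 ?_
  -- the union of the cosets other than `H` itself
  let D : Set Γ := ⋃ x : {x : X // ∃ g ∈ G, g ∉ H ∧ c g = x},
    (x.2.choose⁻¹ * ·) ⁻¹' (H : Set Γ)
  have hD : IsClosed D := isClosed_iUnion_of_finite fun x => hH.preimage (hmul _)
  have hHD : ∀ g ∈ H, g ∉ D := by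
    intro g hg hgD
    obtain ⟨x, hx⟩ := Set.mem_iUnion.1 hgD
    have hx' : x.2.choose⁻¹ * g ∈ H := hx
    apply x.2.choose_spec.2.1
    have := H.mul_mem hg (H.inv_mem hx')
    simpa using this
  have hcov : connectedComponentIn (G : Set Γ) 1 ⊆ (H : Set Γ) ∪ D := by
    intro g hg
    have hgG := connectedComponentIn_subset _ _ hg
    by_cases hgH : g ∈ H
    · exact Or.inl hgH
    · have hx : ∃ g' ∈ G, g' ∉ H ∧ c g' = c g := ⟨g, hgG, hgH, rfl⟩
      exact Or.inr (Set.mem_iUnion.2 ⟨⟨c g, hx⟩,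
        hc _ hx.choose_spec.1 g hgG hx.choose_spec.2.2⟩)
  intro g hg
  by_contra hgH
  obtain ⟨h, -, hhH, hhD⟩ := isPreconnected_closed_iff.1 isPreconnected_connectedComponentIn _ _ hH hD
    hcov ⟨1, h1, H.one_mem⟩ ⟨g, hg, (hcov hg).resolve_left hgH⟩
  exact hHD h hhH hhD

theorem isClosed_zariskiGL_iff {Z : Set (GL (Fin 2) ℂ)} :
    IsClosed[zariskiGL] Z ↔
      ∃ S : Set (MvPolynomial (Option (Fin 2 × Fin 2)) ℂ), Z = {A | ∀ p ∈ S, evalGL p A = 0} := by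
  rw [← @isOpen_compl_iff _ _ zariskiGL]
  change Zᶜᶜ ∈ {Z | _} ↔ _
  rw [compl_compl]
  rfl

theorem continuous_mul_left_zariskiGL (g : GL (Fin 2) ℂ) :
    @Continuous _ _ zariskiGL zariskiGL (g * ·) := by
  let : TopologicalSpace (GL (Fin 2) ℂ) := zariskiGL
  refine continuous_iff_isClosed.2 fun Z hZ => ?_
  obtain ⟨S, rfl⟩ := isClosed_zariskiGL_iff.1 hZ
  let s : Option (Fin 2 × Fin 2) → MvPolynomial (Option (Fin 2 × Fin 2)) ℂ := fun v =>
    v.elim (MvPolynomial.C (g : Matrix (Fin 2) (Fin 2) ℂ).det⁻¹ * MvPolynomial.X none)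
      fun ij => ∑ k, MvPolynomial.C ((g : Matrix (Fin 2) (Fin 2) ℂ) ij.1 k) *
        MvPolynomial.X (some (k, ij.2))
  have hs : ∀ p A, evalGL (MvPolynomial.bind₁ s p) A = evalGL p (g * A) := by
    intro p A
    simp only [evalGL, MvPolynomial.eval, MvPolynomial.eval₂Hom_bind₁]
    congr 2
    ext v
    rcases v with _ | ⟨i, j⟩
    · simp [s, mul_comm]
    · simp [s, Matrix.mul_apply]
  refine isClosed_zariskiGL_iff.2 ⟨MvPolynomial.bind₁ s '' S, ?_⟩
  ext A
  simp [hs]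

/-- The polynomial obtained by applying a linear form to the coefficients. -/
def mapLinearForm {σ E : Type*} [CommRing E] [Algebra ℂ E] (l : E →ₗ[ℂ] ℂ) (q : MvPolynomial σ E) :
    MvPolynomial σ ℂ :=
  ∑ m ∈ q.support, MvPolynomial.monomial m (l (q.coeff m))

theorem eval_mapLinearForm {σ E : Type*} [CommRing E] [Algebra ℂ E] (l : E →ₗ[ℂ] ℂ)
    (q : MvPolynomial σ E) (a : σ → ℂ) :
    MvPolynomial.eval a (mapLinearForm l q) =
      l (MvPolynomial.eval (fun i => algebraMap ℂ E (a i)) q) := by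
  rw [mapLinearForm, map_sum, MvPolynomial.eval_eq _ q, map_sum]
  refine Finset.sum_congr rfl fun m _ => ?_
  rw [MvPolynomial.eval_monomial, Finsupp.prod]
  simp only [← map_pow, ← map_prod]
  rw [mul_comm (q.coeff m), ← Algebra.smul_def, map_smul, smul_eq_mul, mul_comm]

/-- Being a constant matrix that preserves the relations of `Y` is an algebraic condition: the
coordinates over `ℂ` of `p (Y A)` are polynomials in the entries of `A`. -/
theorem isClosed_preserves_relationIdeal {F E : Type*} [Field F] [CommRing E] [Algebra F E]
    [Algebra ℂ E] (Y : Matrix (Fin 2) (Fin 2) E) :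
    IsClosed[zariskiGL] {A : GL (Fin 2) ℂ | relationIdeal F Y ≤
      relationIdeal F (Y * (A : Matrix (Fin 2) (Fin 2) ℂ).map (algebraMap ℂ E))} := by
  let Q : MvPolynomial (Fin 2 × Fin 2) F → MvPolynomial (Fin 2 × Fin 2) E := fun p =>
    MvPolynomial.aeval (fun k => ∑ i, MvPolynomial.C (Y k.1 i) * MvPolynomial.X (i, k.2)) p
  have hQ : ∀ (A : GL (Fin 2) ℂ) p,
      MvPolynomial.eval (fun k => algebraMap ℂ E ((A : Matrix (Fin 2) (Fin 2) ℂ) k.1 k.2)) (Q p) =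
        MvPolynomial.aeval (fun k : Fin 2 × Fin 2 =>
          (Y * (A : Matrix (Fin 2) (Fin 2) ℂ).map (algebraMap ℂ E)) k.1 k.2) p := by
    intro A p
    have h1 : ∀ f : Fin 2 × Fin 2 → E, ∀ q : MvPolynomial (Fin 2 × Fin 2) E,
      MvPolynomial.eval f q = (MvPolynomial.aeval f).restrictScalars F q := fun f q => by
        rw [AlgHom.restrictScalars_apply, MvPolynomial.aeval_eq_eval]
    rw [h1, ← AlgHom.comp_apply, MvPolynomial.comp_aeval]
    congr 2
    ext k
    simp [Matrix.mul_apply]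
  have hev : ∀ (q : MvPolynomial (Fin 2 × Fin 2) ℂ) (A : GL (Fin 2) ℂ),
      evalGL (MvPolynomial.rename some q) A =
        MvPolynomial.eval (fun k => (A : Matrix (Fin 2) (Fin 2) ℂ) k.1 k.2) q := by
    intro q A
    rw [evalGL, MvPolynomial.eval_rename]
    rfl
  refine isClosed_zariskiGL_iff.2 ⟨{q | ∃ p ∈ relationIdeal F Y, ∃ l : E →ₗ[ℂ] ℂ,
    q = MvPolynomial.rename some (mapLinearForm l (Q p))}, ?_⟩
  ext A
  simp only [Set.mem_ofPred_eq]
  constructor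
  · rintro h _ ⟨p, hp, l, rfl⟩
    rw [hev, eval_mapLinearForm, hQ, mem_relationIdeal.1 (h hp), map_zero]
  · intro h p hp
    rw [mem_relationIdeal, ← hQ, ← Module.forall_dual_apply_eq_zero_iff ℂ]
    intro l
    rw [← eval_mapLinearForm, ← hev]
    exact h _ ⟨p, hp, l, rfl⟩

end Zariski

/-! ### Differential embeddings -/

section Generation

/-- The chain rule `∂ (φ f) = t φ (∂ f)` holds everywhere if it holds on a set of generators. -/
theorem chain_rule_of_adjoin_eq_top {F E M : Type*} [Field F] [Field E] [Field M] [Algebra F E]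
    (dE : Derivation ℤ E E) (dM : Derivation ℤ M M) (φ : E →+* M) (t : M) {S : Set E}
    (hS : IntermediateField.adjoin F S = ⊤)
    (hF : ∀ f : F, dM (φ (algebraMap F E f)) = t * φ (dE (algebraMap F E f)))
    (h : ∀ x ∈ S, dM (φ x) = t * φ (dE x)) (x : E) : dM (φ x) = t * φ (dE x) := by
  have hx : x ∈ IntermediateField.adjoin F S := hS ▸ IntermediateField.mem_top
  induction hx using IntermediateField.adjoin_induction with
  | mem x hx => exact h x hx
  | algebraMap f => exact hF f
  | add x y _ _ hx hy => simp only [map_add, hx, hy, mul_add]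
  | inv x _ hx =>
    rw [map_inv₀, Derivation.leibniz_inv, Derivation.leibniz_inv, hx]
    simp only [smul_eq_mul, map_mul, map_neg, map_pow, map_inv₀]
    ring
  | mul x y _ _ hx hy =>
    simp only [map_mul, map_add, Derivation.leibniz, smul_eq_mul, hx, hy]
    ring

/-- If two fundamental matrices of the same differential system have the same relations, and the
first one generates its field, then there is a differential embedding that maps one to the other. -/
theorem exists_algHom_of_relationIdeal_eq {n F L M : Type*} [Fintype n] [Field F] [Field L]
    [Field M] [Algebra F L] [Algebra F M] (dF : Derivation ℤ F F) (dL : Derivation ℤ L L)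
    (dM : Derivation ℤ M M) (hL : ∀ f, dL (algebraMap F L f) = algebraMap F L (dF f))
    (hM : ∀ f, dM (algebraMap F M f) = algebraMap F M (dF f)) (N : Matrix n n F)
    {Y : Matrix n n L} {R : Matrix n n M} (dY : Y.map dL = N.map (algebraMap F L) * Y)
    (dR : R.map dM = N.map (algebraMap F M) * R)
    (hY : IntermediateField.adjoin F (Set.range fun k : n × n => Y k.1 k.2) = ⊤)
    (h : relationIdeal F Y = relationIdeal F R) :
    ∃ φ : L →ₐ[F] M, Y.map φ = R ∧ ∀ l, dM (φ l) = φ (dL l) := by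
  obtain ⟨φ, hφ⟩ := exists_algHom_of_ker_aeval_eq _ (fun k : n × n => R k.1 k.2) hY h
  have hφ' : Y.map φ = R := by ext i j; exact hφ (i, j)
  refine ⟨φ, hφ', fun l => ?_⟩
  rw [← one_mul (φ (dL l))]
  refine chain_rule_of_adjoin_eq_top dL dM φ.toRingHom 1 hY (fun f => ?_) ?_ l
  · change dM (φ _) = 1 * φ _
    rw [one_mul, φ.commutes, hL, φ.commutes, hM]
  · rintro _ ⟨k, rfl⟩
    have h1 : R.map dM = (Y.map dL).map φ := by
      rw [dR, dY, Matrix.map_mul, hφ']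
      congr 1
      ext i j
      simp
    have h2 := congrFun (congrFun h1 k.1) k.2
    rw [← hφ'] at h2
    rw [one_mul]
    exact h2

end Generation

/-! ### Wronskian matrices -/

section Wronskian

/-- The Wronskian matrix of two functions. -/
def wronskianMatrix {E : Type*} [CommRing E] (d : Derivation ℤ E E) (y : Fin 2 → E) :
    Matrix (Fin 2) (Fin 2) E :=
  Matrix.of ![y, fun i => d (y i)]

/-- The matrix of the first order system that corresponds to `y'' + a y' + b y = 0`. -/
def companionMatrix {F : Type*} [CommRing F] (a b : F) : Matrix (Fin 2) (Fin 2) F :=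
  !![0, 1; -b, -a]

theorem wronskianMatrix_map_derivation {F E : Type*} [CommRing F] [CommRing E] [Algebra F E]
    (d : Derivation ℤ E E) (a b : F) (y : Fin 2 → E)
    (h : ∀ i, d (d (y i)) + algebraMap F E a * d (y i) + algebraMap F E b * y i = 0) :
    (wronskianMatrix d y).map d =
      (companionMatrix a b).map (algebraMap F E) * wronskianMatrix d y := by
  ext i j
  fin_cases i
  · simp [wronskianMatrix, companionMatrix, Matrix.mul_apply]
  · simp only [wronskianMatrix, companionMatrix, Matrix.mul_apply, Fin.sum_univ_two]
    simp
    linear_combination h j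

theorem derivation_smul_of_constants {k E : Type*} [Field k] [CommRing E] [Algebra k E]
    (d : Derivation ℤ E E) (hk : ∀ c, d (algebraMap k E c) = 0) (c : k) (f : E) :
    d (c • f) = c • d f := by
  rw [Algebra.smul_def, Derivation.leibniz, hk, smul_zero, add_zero, smul_eq_mul, Algebra.smul_def]

theorem wronskianMatrix_smul {k E : Type*} [Field k] [CommRing E] [Algebra k E]
    (d : Derivation ℤ E E) (hk : ∀ c, d (algebraMap k E c) = 0) (A : Matrix (Fin 2) (Fin 2) k)
    (y : Fin 2 → E) :
    wronskianMatrix d (fun j => ∑ i, A i j • y i) = wronskianMatrix d y * A.map (algebraMap k E) := by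
  ext i j
  fin_cases i
  · simp [wronskianMatrix, Matrix.mul_apply, Algebra.smul_def, mul_comm]
  · change d (∑ i, A i j • y i) = ∑ i, d (y i) * algebraMap k E (A i j)
    rw [map_sum]
    refine Finset.sum_congr rfl fun i _ => ?_
    rw [derivation_smul_of_constants d hk, Algebra.smul_def, mul_comm]

/-- Functions that are independent over the constants have a nonzero Wronskian. -/
theorem det_wronskianMatrix_ne_zero {k E : Type*} [Field k] [Field E] [Algebra k E]
    (d : Derivation ℤ E E) (hk : ∀ f, d f = 0 → f ∈ (algebraMap k E).range) {y : Fin 2 → E}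
    (hy : LinearIndependent k y) : (wronskianMatrix d y).det ≠ 0 := by
  intro h
  have h0 : y 0 ≠ 0 := hy.ne_zero 0
  simp only [wronskianMatrix, Matrix.det_fin_two, Matrix.of_apply, Matrix.cons_val_zero,
    Matrix.cons_val_one] at h
  have h1 : d (y 1 / y 0) = 0 := by
    rw [Derivation.leibniz_div]
    simp only [smul_eq_mul]
    rw [mul_eq_zero]
    right
    linear_combination h
  obtain ⟨c, hc⟩ := hk _ h1
  rw [eq_div_iff h0, ← Algebra.smul_def] at hc
  have h2 := (LinearIndependent.pair_iff.1
    (show LinearIndependent k ![y 0, y 1] from by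
      convert hy using 1
      ext i
      fin_cases i <;> rfl)) c (-1) (by rw [hc]; simp)
  simp at h2

end Wronskian

/-! ### The differential Galois group of a Picard-Vessiot extension -/

section PicardVessiotGroup

theorem deriv_algebraMap_eq {F E : Type*} [CommRing F] [CommRing E] [Algebra F E] [Differential F]
    [Differential E] [DifferentialAlgebra F E] (f : F) :
    Differential.deriv (algebraMap F E f) = algebraMap F E (Differential.deriv f) :=
  (algebraMap.coe_deriv f).symm

variable {F E : Type*} [Field F] [Field E] [Algebra ℂ E] [Algebra F E] [Differential E]

theorem ConstantsAreComplex.deriv_algebraMap (h : ConstantsAreComplex E) (c : ℂ) :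
    Differential.deriv (algebraMap ℂ E c) = 0 :=
  (h _).2 ⟨c, rfl⟩

theorem IsFundamentalSystem.map_deriv {a b : F} {y : Fin 2 → E} (hy : IsFundamentalSystem E a b y) :
    (wronskianMatrix Differential.deriv y).map Differential.deriv =
      (companionMatrix a b).map (algebraMap F E) * wronskianMatrix Differential.deriv y :=
  wronskianMatrix_map_derivation _ a b y hy.solution

variable [Algebra ℂ F] [IsScalarTower ℂ F E]

/-- Every fundamental system, together with its derivatives, generates a Picard-Vessiot
extension. -/
theorem IsPicardVessiot.adjoin_eq_top {a b : F} (hE : IsPicardVessiot E a b) {y : Fin 2 → E}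
    (hy : IsFundamentalSystem E a b y) :
    IntermediateField.adjoin F (Set.range fun k : Fin 2 × Fin 2 =>
      wronskianMatrix Differential.deriv y k.1 k.2) = ⊤ := by
  obtain ⟨z, hz, hadj⟩ := hE.generated
  rw [eq_top_iff, ← hadj, IntermediateField.adjoin_le_iff]
  set S := IntermediateField.adjoin F (Set.range fun k : Fin 2 × Fin 2 =>
      wronskianMatrix Differential.deriv y k.1 k.2) with hS
  have hyS : ∀ i, y i ∈ S := fun i => IntermediateField.subset_adjoin _ _ ⟨(0, i), rfl⟩
  have hyS' : ∀ i, (y i)′ ∈ S := fun i => IntermediateField.subset_adjoin _ _ ⟨(1, i), rfl⟩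
  have hsm : ∀ (c : ℂ) {f : E}, f ∈ S → c • f ∈ S := fun c f hf => by
    rw [← algebraMap_smul F c f]
    exact S.smul_mem hf
  rintro _ (⟨i, rfl⟩ | ⟨i, rfl⟩)
  · obtain ⟨c, hc⟩ := (Submodule.mem_span_range_iff_exists_fun ℂ).1 (hy.mem_span _ (hz.solution i))
    rw [← hc]
    exact sum_mem fun j _ => hsm _ (hyS j)
  · obtain ⟨c, hc⟩ := (Submodule.mem_span_range_iff_exists_fun ℂ).1 (hy.mem_span _ (hz.solution i))
    change (z i)′ ∈ S
    rw [← hc, map_sum]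
    refine sum_mem fun j _ => ?_
    rw [derivation_smul_of_constants _ hE.constants.deriv_algebraMap]
    exact hsm _ (hyS' j)

variable [Differential F] [DifferentialAlgebra F E]

/-- A matrix belongs to the differential Galois group if and only if it preserves the algebraic
relations of a fundamental system and its derivatives. -/
theorem mem_DGalMatrix_iff {a b : F} (hE : IsPicardVessiot E a b) {y : Fin 2 → E}
    (hy : IsFundamentalSystem E a b y) (A : GL (Fin 2) ℂ) :
    A ∈ DGalMatrix F y ↔ relationIdeal F (wronskianMatrix Differential.deriv y) ≤
      relationIdeal F (wronskianMatrix Differential.deriv y *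
        (A : Matrix (Fin 2) (Fin 2) ℂ).map (algebraMap ℂ E)) := by
  have hW := wronskianMatrix_smul Differential.deriv hE.constants.deriv_algebraMap
    (A : Matrix (Fin 2) (Fin 2) ℂ) y
  constructor
  · rintro ⟨σ, hσ, hA⟩
    have h1 : (wronskianMatrix Differential.deriv y).map σ =
        wronskianMatrix Differential.deriv y *
          (A : Matrix (Fin 2) (Fin 2) ℂ).map (algebraMap ℂ E) := by
      rw [← hW]
      ext i j
      fin_cases i
      · exact hA j
      · exact (hσ _).trans (congrArg _ (hA j))
    rw [← h1]
    exact (relationIdeal_map σ.toAlgHom σ.injective _).ge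
  · intro h
    obtain ⟨φ, hφ, hd⟩ := exists_algHom_of_relationIdeal_eq Differential.deriv Differential.deriv
      Differential.deriv (deriv_algebraMap_eq (F := F) (E := E)) deriv_algebraMap_eq
      (companionMatrix a b) hy.map_deriv (R := wronskianMatrix Differential.deriv y *
          (A : Matrix (Fin 2) (Fin 2) ℂ).map (algebraMap ℂ E)) (by
        rw [Matrix.map_derivation_mul, hy.map_deriv, Matrix.mul_assoc, add_eq_left]
        convert Matrix.mul_zero _
        ext i j
        exact hE.constants.deriv_algebraMap _)
      (hE.adjoin_eq_top hy) (relationIdeal_mul_constant_eq_of_le A _ h).symm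
    have hsurj : Function.Surjective φ := by
      rw [← Set.range_eq_univ, ← AlgHom.coe_fieldRange, ← IntermediateField.coe_top (F := F),
        SetLike.coe_set_eq, eq_top_iff, ← hE.adjoin_eq_top hy, IntermediateField.adjoin_le_iff]
      rintro _ ⟨k, rfl⟩
      have h1 : (wronskianMatrix Differential.deriv y *
          ((A⁻¹ : GL (Fin 2) ℂ) : Matrix (Fin 2) (Fin 2) ℂ).map (algebraMap ℂ E)).map φ =
          wronskianMatrix Differential.deriv y := by
        have h2 : (((A⁻¹ : GL (Fin 2) ℂ) : Matrix (Fin 2) (Fin 2) ℂ).map (algebraMap ℂ E)).map φ =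
            ((A⁻¹ : GL (Fin 2) ℂ) : Matrix (Fin 2) (Fin 2) ℂ).map (algebraMap ℂ E) := by
          ext i j
          exact (φ.restrictScalars ℂ).commutes _
        rw [Matrix.map_mul, hφ, h2, Matrix.mul_assoc, ← Matrix.map_mul, ← Units.val_mul,
          mul_inv_cancel, Units.val_one, Matrix.map_one _ (map_zero _) (map_one _), Matrix.mul_one]
      exact ⟨_, congrFun (congrFun h1 k.1) k.2⟩
    refine ⟨AlgEquiv.ofBijective φ ⟨φ.injective, hsurj⟩, fun f => (hd f).symm, fun j => ?_⟩
    have h1 := congrFun (congrFun hφ 0) j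
    rw [← hW] at h1
    exact h1

end PicardVessiotGroup

/-! ### Embeddings of Picard-Vessiot extensions -/

section Embedding

/-- A Picard-Vessiot extension embeds into every differential extension without new constants that
contains two independent solutions. -/
theorem IsPicardVessiot.exists_algHom {F L M : Type*} [Field F] [Differential F] [Algebra ℂ F]
    [Field L] [Algebra ℂ L] [Algebra F L] [IsScalarTower ℂ F L] [Differential L]
    [DifferentialAlgebra F L] [Field M] [Algebra ℂ M] [Algebra F M] [IsScalarTower ℂ F M]
    {a b : F} (hL : IsPicardVessiot L a b) (d : Derivation ℤ M M)
    (hd : ∀ f, d (algebraMap F M f) = algebraMap F M f′)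
    (hk : ∀ m, d m = 0 ↔ m ∈ (algebraMap ℂ M).range) {r : Fin 2 → M} (hr : LinearIndependent ℂ r)
    (hsol : ∀ i, d (d (r i)) + algebraMap F M a * d (r i) + algebraMap F M b * r i = 0) :
    ∃ φ : L →ₐ[F] M, ∀ l, d (φ l) = φ l′ := by
  obtain ⟨y, hy, -⟩ := hL.generated
  have dR := wronskianMatrix_map_derivation d a b r hsol
  obtain ⟨C, hC⟩ := exists_relationIdeal_eq Differential.deriv d Differential.deriv hd
    (deriv_algebraMap_eq (F := F) (E := L)) hk hL.constants (companionMatrix a b)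
    (det_wronskianMatrix_ne_zero d (fun m => (hk m).1) hr)
    (det_wronskianMatrix_ne_zero _ (fun l => (hL.constants l).1) hy.linearIndependent) dR
    hy.map_deriv
  obtain ⟨φ, -, hφ⟩ := exists_algHom_of_relationIdeal_eq Differential.deriv Differential.deriv d
    (deriv_algebraMap_eq (F := F) (E := L)) hd (companionMatrix a b) hy.map_deriv
    (R := wronskianMatrix d r * (C : Matrix (Fin 2) (Fin 2) ℂ).map (algebraMap ℂ M)) (by
        rw [Matrix.map_derivation_mul, dR, Matrix.mul_assoc, add_eq_left]
        convert Matrix.mul_zero _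
        ext i j
        exact (hk _).2 ⟨_, rfl⟩)
    (hL.adjoin_eq_top hy) hC
  exact ⟨φ, hφ⟩

end Embedding

/-! ### Extension of automorphisms to an algebraic extension -/

section FiniteIndex

variable {F K L M Ω : Type*} [Field F] [Field K] [Field L] [Field M] [Field Ω] [Algebra F L]
  [Algebra F M] [Algebra K M] [Algebra F Ω] [Algebra M Ω] [IsScalarTower F M Ω]

/-- If `M` is generated over the field `φ L` by elements that are algebraic over `F`, then every
automorphism of `L` over `F` extends to an embedding of `M` into an algebraically closed field. -/
theorem exists_algHom_extending [Algebra F K] [IsScalarTower F K M] [Algebra.IsAlgebraic F K]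
    [IsAlgClosed Ω] (φ : L →ₐ[F] M)
    (hM : IntermediateField.adjoin K (Set.range φ) = ⊤) (σ : L ≃ₐ[F] L) :
    ∃ τ : M →ₐ[F] Ω, ∀ l, τ (φ l) = algebraMap M Ω (φ (σ l)) := by
  let : Algebra L M := φ.toRingHom.toAlgebra
  have hLM : ∀ l, algebraMap L M l = φ l := fun _ => rfl
  have : IsScalarTower F L M := .of_algebraMap_eq fun f => (φ.commutes f).symm
  have : Algebra.IsAlgebraic L M := ⟨fun x => by
    have hx : x ∈ IntermediateField.adjoin K (Set.range φ) := hM ▸ IntermediateField.mem_top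
    induction hx using IntermediateField.adjoin_induction with
    | mem x hx =>
      obtain ⟨l, rfl⟩ := hx
      exact isAlgebraic_algebraMap l
    | algebraMap x =>
      have h1 : IsAlgebraic F (algebraMap K M x) :=
        (Algebra.IsAlgebraic.isAlgebraic x).algebraMap
      exact h1.tower_top L
    | add x y _ _ hx hy => exact hx.add hy
    | inv x _ hx => exact hx.inv
    | mul x y _ _ hx hy => exact hx.mul hy⟩
  let : Algebra L Ω := ((algebraMap M Ω).comp (φ.toRingHom.comp σ.toRingEquiv.toRingHom)).toAlgebra
  let τ : M →ₐ[L] Ω := IsAlgClosed.lift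
  refine ⟨{ τ.toRingHom with commutes' := fun f => ?_ }, fun l => τ.commutes l⟩
  change τ (algebraMap F M f) = _
  rw [IsScalarTower.algebraMap_apply F L M, τ.commutes]
  change algebraMap M Ω (φ (σ (algebraMap F L f))) = _
  rw [σ.commutes, φ.commutes, ← IsScalarTower.algebraMap_apply]

variable [Algebra ℂ F] [Algebra ℂ M] [IsScalarTower ℂ F M]

/-- Two embeddings of `M` that agree on `K` and act on `Z` through constant matrices: the quotient
of these matrices preserves the relations of `Z` over `K`. -/
theorem relationIdeal_inv_mul_of_agree {n : Type*} [Fintype n] [DecidableEq n] (Z : Matrix n n M)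
    (τ₁ τ₂ : M →ₐ[F] Ω) (hτ : ∀ x : K, τ₁ (algebraMap K M x) = τ₂ (algebraMap K M x))
    (A₁ A₂ : GL n ℂ)
    (h₁ : Z.map τ₁ = (Z * (A₁ : Matrix n n ℂ).map (algebraMap ℂ M)).map (algebraMap M Ω))
    (h₂ : Z.map τ₂ = (Z * (A₂ : Matrix n n ℂ).map (algebraMap ℂ M)).map (algebraMap M Ω)) :
    relationIdeal K Z ≤
      relationIdeal K (Z * ((A₂⁻¹ * A₁ : GL n ℂ) : Matrix n n ℂ).map (algebraMap ℂ M)) := by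
  let : Algebra K Ω := (τ₁.toRingHom.comp (algebraMap K M)).toAlgebra
  let t₁ : M →ₐ[K] Ω := { τ₁.toRingHom with commutes' := fun x => rfl }
  let t₂ : M →ₐ[K] Ω := { τ₂.toRingHom with commutes' := fun x => (hτ x).symm }
  have hc : ∀ c : ℂ, τ₂ (algebraMap ℂ M c) = algebraMap M Ω (algebraMap ℂ M c) := fun c => by
    rw [IsScalarTower.algebraMap_apply ℂ F M, τ₂.commutes, IsScalarTower.algebraMap_apply F M Ω]
  have h3 : (Z * ((A₂⁻¹ * A₁ : GL n ℂ) : Matrix n n ℂ).map (algebraMap ℂ M)).map t₂ = Z.map t₁ := by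
    have h4 : ∀ A : Matrix n n ℂ, (A.map (algebraMap ℂ M)).map t₂ =
        (A.map (algebraMap ℂ M)).map (algebraMap M Ω) := fun A => by
      ext i j
      exact hc _
    rw [Matrix.map_mul, h4, show Z.map t₂ = _ from h₂, show Z.map t₁ = _ from h₁, ← Matrix.map_mul,
      Matrix.mul_assoc, ← Matrix.map_mul, ← Units.val_mul, mul_inv_cancel_left]
  rw [← relationIdeal_map t₁ t₁.injective, ← h3, relationIdeal_map t₂ t₂.injective]

end FiniteIndex

/-! ### Derivatives of algebraic elements -/

section AlgebraicDerivative

/-- If `α` is algebraic over `F`, then `F(α)` is closed under every derivation that maps `F`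
into `F(α)`. -/
theorem derivation_mem_adjoin_simple {F K : Type*} [Field F] [CharZero F] [Field K] [Algebra F K]
    (d : Derivation ℤ K K) {α : K} (hα : IsAlgebraic F α)
    (hF : ∀ f, d (algebraMap F K f) ∈ IntermediateField.adjoin F {α}) {x : K}
    (hx : x ∈ IntermediateField.adjoin F {α}) : d x ∈ IntermediateField.adjoin F {α} := by
  set S := IntermediateField.adjoin F {α}
  have hαS : α ∈ S := IntermediateField.mem_adjoin_simple_self F α
  have haeval : ∀ p : Polynomial F, Polynomial.aeval α p ∈ S := fun p =>
    IntermediateField.algebra_adjoin_le_adjoin F {α} (Polynomial.aeval_mem_adjoin_singleton F α)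
  have key : ∀ p : Polynomial F, d (Polynomial.aeval α p) -
      Polynomial.aeval α (Polynomial.derivative p) * d α ∈ S := by
    intro p
    induction p using Polynomial.induction_on' with
    | add p q hp hq =>
      simp only [map_add]
      convert S.add_mem hp hq using 1
      ring
    | monomial n c =>
      have h1 : d (Polynomial.aeval α (Polynomial.monomial n c)) -
          Polynomial.aeval α (Polynomial.derivative (Polynomial.monomial n c)) * d α =
          α ^ n * d (algebraMap F K c) := by
        rw [Polynomial.aeval_monomial, Polynomial.derivative_monomial, Polynomial.aeval_monomial,
          Derivation.leibniz, Derivation.leibniz_pow]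
        simp only [smul_eq_mul, nsmul_eq_mul, map_mul, map_natCast]
        ring
      rw [h1]
      exact S.mul_mem (pow_mem hαS n) (hF c)
  have hd : d α ∈ S := by
    have h1 := key (minpoly F α)
    rw [minpoly.aeval, map_zero, zero_sub, ← neg_mul] at h1
    have h2 : -Polynomial.aeval α (Polynomial.derivative (minpoly F α)) ≠ 0 :=
      neg_ne_zero.2 ((minpoly.irreducible hα.isIntegral).separable.aeval_derivative_ne_zero
        (minpoly.aeval F α))
    have h3 := S.mul_mem (S.inv_mem (S.neg_mem (haeval (Polynomial.derivative (minpoly F α))))) h1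
    rwa [inv_mul_cancel_left₀ h2] at h3
  induction hx using IntermediateField.adjoin_induction with
  | mem x hx => rw [Set.mem_singleton_iff.1 hx]; exact hd
  | algebraMap f => exact hF f
  | add x y _ _ hx hy => rw [map_add]; exact S.add_mem hx hy
  | inv x hx' hx =>
    rw [Derivation.leibniz_inv]
    exact S.mul_mem (S.neg_mem (pow_mem (S.inv_mem hx') 2)) hx
  | mul x y hx' hy' hx hy =>
    rw [Derivation.leibniz]
    exact S.add_mem (S.mul_mem hx' hy) (S.mul_mem hy' hx)

end AlgebraicDerivative

/-! ### The transformed operator -/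

section ChangeOfVariable

/-- An embedding `φ` with `∂ (φ f) = t φ (∂ f)` transforms the operator `∂² + a ∂ + b` into
`∂² + (t a - t' / t) ∂ + t² b`, up to the factor `t²`. -/
theorem secondOrderOp_of_chain_rule {F E K M : Type*} [Field F] [Field E] [Field K] [Field M]
    [Algebra F E] [Algebra K M] [Differential E] [Differential M] (φ : E →+* M) {t : M}
    (ht : t ≠ 0) (hφ : ∀ f, (φ f)′ = t * φ f′) {a b : F} {a₁ b₁ : K}
    (ha : algebraMap K M a₁ = φ (algebraMap F E a) * t - t′ / t)
    (hb : algebraMap K M b₁ = φ (algebraMap F E b) * t ^ 2) (y : E) :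
    secondOrderOp M a₁ b₁ (φ y) = t ^ 2 * φ (secondOrderOp E a b y) := by
  have h1 : (φ y)′′ = t′ * φ y′ + t ^ 2 * φ y′′ := by
    rw [hφ, Derivation.leibniz, smul_eq_mul, smul_eq_mul, hφ]
    ring
  rw [secondOrderOp, secondOrderOp, h1, ha, hb, hφ y]
  simp only [map_add, map_mul]
  field_simp
  ring

end ChangeOfVariable

/-! ### Fundamental systems from independent solutions -/

section FundamentalSystem

variable {F E : Type*} [Field F] [Field E] [Algebra ℂ E] [Algebra F E] [Differential E]

/-- The solution space of an equation with a fundamental system has dimension two, so two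
independent solutions span it. -/
theorem IsPicardVessiot.isFundamentalSystem {a b : F} (hE : IsPicardVessiot E a b) {y : Fin 2 → E}
    (hsol : ∀ i, secondOrderOp E a b (y i) = 0) (hy : LinearIndependent ℂ y) :
    IsFundamentalSystem E a b y := by
  obtain ⟨r, hr, -⟩ := hE.generated
  refine ⟨hsol, hy, fun f hf => ?_⟩
  have h1 : Submodule.span ℂ (Set.range y) ≤ Submodule.span ℂ (Set.range r) := by
    rw [Submodule.span_le]
    rintro _ ⟨i, rfl⟩
    exact hr.mem_span _ (hsol i)
  have : FiniteDimensional ℂ (Submodule.span ℂ (Set.range r)) :=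
    FiniteDimensional.span_of_finite ℂ (Set.finite_range r)
  rw [Submodule.eq_of_le_of_finrank_eq h1 (by
    rw [finrank_span_eq_card hy, finrank_span_eq_card hr.linearIndependent])]
  exact hr.mem_span f hf

end FundamentalSystem

/-! ### Comparison of the identity components -/

section IdentityComponent

open scoped Topology

/-- Rescaling the derivation of `M` by an element of the base field `K` does not change the
Galois group: it may be computed with the image of a Wronskian matrix under a substitution. -/
theorem mem_DGalMatrix_iff_of_chain_rule {K L M : Type*} [Field K] [CommRing L] [Field M]
    [Algebra ℂ K] [Algebra ℂ M] [Algebra K M] [IsScalarTower ℂ K M] [Differential K]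
    [Differential L] [Differential M] [DifferentialAlgebra K M] {a₁ b₁ : K}
    (hM : IsPicardVessiot M a₁ b₁) {t : K}
    (ht : t ≠ 0) (φ : L → M) (hφ : ∀ f, (φ f)′ = algebraMap K M t * φ f′) {y : Fin 2 → L}
    (hφy : IsFundamentalSystem M a₁ b₁ fun i => φ (y i)) (A : GL (Fin 2) ℂ) :
    A ∈ DGalMatrix K (fun i => φ (y i)) ↔
      relationIdeal K ((wronskianMatrix Differential.deriv y).map φ) ≤
        relationIdeal K ((wronskianMatrix Differential.deriv y).map φ *
          (A : Matrix (Fin 2) (Fin 2) ℂ).map (algebraMap ℂ M)) := by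
  rw [mem_DGalMatrix_iff hM hφy]
  set Z := (wronskianMatrix Differential.deriv y).map φ
  set W := wronskianMatrix Differential.deriv fun i => φ (y i)
  have ht' : algebraMap K M t ≠ 0 := (map_ne_zero _).2 ht
  have hW : W = (Matrix.diagonal ![1, t]).map (algebraMap K M) * Z := by
    ext i j
    rw [Matrix.diagonal_map (map_zero _), Matrix.diagonal_mul]
    fin_cases i
    · simp [W, Z, wronskianMatrix]
    · simpa [W, Z, wronskianMatrix] using hφ (y j)
  have hZ : Z = (Matrix.diagonal ![1, t⁻¹]).map (algebraMap K M) * W := by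
    rw [hW, ← Matrix.mul_assoc, ← Matrix.map_mul, Matrix.diagonal_mul_diagonal]
    have : (fun i : Fin 2 => (![1, t⁻¹] : Fin 2 → K) i * (![1, t] : Fin 2 → K) i) = 1 := by
      ext i
      fin_cases i <;> simp [ht]
    rw [this, Matrix.diagonal_one', Matrix.map_one _ (map_zero _) (map_one _), Matrix.one_mul]
  constructor
  · intro h
    have := relationIdeal_mul_left_mono (Matrix.diagonal ![1, t⁻¹]) h
    rwa [← Matrix.mul_assoc, ← hZ] at this
  · intro h
    have := relationIdeal_mul_left_mono (Matrix.diagonal ![1, t]) h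
    rwa [← Matrix.mul_assoc, ← hW] at this

variable {F K L M : Type*} [Field F] [Field K] [Field L] [Field M]
  [Algebra ℂ F] [Algebra ℂ K] [Algebra ℂ L] [Algebra ℂ M] [Algebra F K] [Algebra F L] [Algebra F M]
  [Algebra K M] [IsScalarTower ℂ F L] [IsScalarTower ℂ F M] [IsScalarTower ℂ K M]
  [IsScalarTower F K M] [Differential F] [Differential K] [Differential L] [Differential M]
  [DifferentialAlgebra F L] [DifferentialAlgebra K M]

/-- A substitution into a Picard-Vessiot extension over a finite extension of the base field does
not change the identity component of the Galois group: the new group is a closed subgroup of finite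
index of the old one. -/
theorem identityComponent_eq_of_chain_rule [FiniteDimensional F K] {a b : F} {a₁ b₁ : K}
    (hL : IsPicardVessiot L a b) (hM : IsPicardVessiot M a₁ b₁) {t : K} (ht : t ≠ 0)
    (φ : L →ₐ[F] M) (hφ : ∀ f, (φ f)′ = algebraMap K M t * φ f′) {y : Fin 2 → L}
    (hy : IsFundamentalSystem L a b y) (hφy : IsFundamentalSystem M a₁ b₁ fun i => φ (y i)) :
    identityComponent (DGalMatrix K fun i => φ (y i)) = identityComponent (DGalMatrix F y) := by
  set Z := (wronskianMatrix Differential.deriv y).map φ with hZ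
  have hmem := mem_DGalMatrix_iff_of_chain_rule hM ht φ hφ hφy
  have hmap : ∀ A : GL (Fin 2) ℂ, (wronskianMatrix Differential.deriv y *
      (A : Matrix (Fin 2) (Fin 2) ℂ).map (algebraMap ℂ L)).map φ =
      Z * (A : Matrix (Fin 2) (Fin 2) ℂ).map (algebraMap ℂ M) := fun A => by
    rw [Matrix.map_mul]
    congr 1
    ext i j
    exact (φ.restrictScalars ℂ).commutes _
  have hle : DGalMatrix K (fun i => φ (y i)) ≤ DGalMatrix F y := by
    intro A hA
    rw [mem_DGalMatrix_iff hL hy, ← relationIdeal_map φ φ.injective,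
      ← relationIdeal_map φ φ.injective (_ * _), hmap, relationIdeal_eq_comap (K := K),
      relationIdeal_eq_comap (K := K) (Z * _)]
    exact Ideal.comap_mono ((hmem A).1 hA)
  have hclosed : IsClosed[zariskiGL]
      (DGalMatrix K (fun i => φ (y i)) : Set (GL (Fin 2) ℂ)) := by
    convert isClosed_preserves_relationIdeal (F := K) Z using 1
    ext A
    exact hmem A
  have hgen : IntermediateField.adjoin K (Set.range φ) = ⊤ := by
    rw [eq_top_iff, ← hM.adjoin_eq_top hφy, IntermediateField.adjoin_le_iff]
    have h1 : ∀ l, φ l ∈ IntermediateField.adjoin K (Set.range φ) :=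
      fun l => IntermediateField.subset_adjoin _ _ ⟨l, rfl⟩
    rintro _ ⟨⟨i, j⟩, rfl⟩
    fin_cases i
    · exact h1 (y j)
    · change (φ (y j))′ ∈ _
      rw [hφ]
      exact mul_mem (IntermediateField.algebraMap_mem _ t) (h1 _)
  let Ω := AlgebraicClosure M
  -- an extension of an element of the old group to `M` is determined on `K` by one of the finitely
  -- many embeddings of `K` over `F`
  have hext : ∀ A ∈ DGalMatrix F y, ∃ ρ : K →ₐ[F] Ω, ∃ τ : M →ₐ[F] Ω,
      (∀ x, τ (algebraMap K M x) = ρ x) ∧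
      Z.map τ = (Z * (A : Matrix (Fin 2) (Fin 2) ℂ).map (algebraMap ℂ M)).map (algebraMap M Ω) := by
    rintro A ⟨σ, hσ, hA⟩
    obtain ⟨τ, hτ⟩ := exists_algHom_extending (Ω := Ω) φ hgen σ
    refine ⟨τ.comp (IsScalarTower.toAlgHom F K M), τ, fun _ => rfl, ?_⟩
    rw [← hmap, ← wronskianMatrix_smul _ hL.constants.deriv_algebraMap]
    ext i j
    refine (hτ _).trans (congrArg (fun l => algebraMap M Ω (φ l)) ?_)
    fin_cases i
    · exact hA j
    · exact (hσ _).trans (congrArg _ (hA j))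
  have : Nonempty (M →ₐ[F] Ω) := ⟨IsScalarTower.toAlgHom F M Ω⟩
  have : Nonempty (K →ₐ[F] Ω) :=
    ⟨(IsScalarTower.toAlgHom F M Ω).comp (IsScalarTower.toAlgHom F K M)⟩
  choose! c τ hc hτ using hext
  exact @connectedComponentIn_one_eq_of_finite _ (K →ₐ[F] Ω) _ zariskiGL _
    continuous_mul_left_zariskiGL _ _ hle hclosed c fun A hA B hB hAB =>
      (hmem _).2 (relationIdeal_inv_mul_of_agree Z (τ B) (τ A)
        (fun x => by rw [hc _ hA, hc _ hB, hAB]) B A (hτ _ hB) (hτ _ hA))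

end IdentityComponent

/-! ### Substitution in rational functions -/

section RationalFunctions

theorem RatFunc.algHom_eq_of_apply_X {A : Type*} [Field A] [Algebra ℂ A]
    {f g : RatFunc ℂ →ₐ[ℂ] A} (h : f RatFunc.X = g RatFunc.X) : f = g := by
  refine AlgHom.ext fun x => ?_
  have hx : x ∈ IntermediateField.adjoin ℂ {(RatFunc.X : RatFunc ℂ)} :=
    RatFunc.adjoin_X (K := ℂ) ▸ IntermediateField.mem_top
  induction hx using IntermediateField.adjoin_induction with
  | mem x hx => rw [Set.mem_singleton_iff.1 hx, h]
  | algebraMap c => rw [f.commutes, g.commutes]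
  | add x y _ _ hx hy => rw [map_add, map_add, hx, hy]
  | inv x _ hx => rw [map_inv₀, map_inv₀, hx]
  | mul x y _ _ hx hy => rw [map_mul, map_mul, hx, hy]

theorem RatFunc.deriv_algebraMap_polynomial (p : Polynomial ℂ) :
    (algebraMap (Polynomial ℂ) (RatFunc ℂ) p)′ =
      algebraMap (Polynomial ℂ) (RatFunc ℂ) (Polynomial.derivative p) := by
  have h := ratFuncDeriv_div p 1 one_ne_zero
  rw [map_one, div_one] at h
  refine h.trans ?_
  simp

theorem RatFunc.deriv_X : (RatFunc.X : RatFunc ℂ)′ = 1 := by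
  simpa using RatFunc.deriv_algebraMap_polynomial Polynomial.X

theorem RatFunc.deriv_algebraMap (c : ℂ) : Differential.deriv (algebraMap ℂ (RatFunc ℂ) c) = 0 := by
  simpa using RatFunc.deriv_algebraMap_polynomial (Polynomial.C c)

/-- Substitution of an element outside `ℂ` in rational functions: it is transcendental, because `ℂ`
is algebraically closed. -/
theorem exists_algHom_ratFunc {K : Type*} [Field K] [Algebra ℂ K] (θ : K)
    (hθ : θ ∉ (algebraMap ℂ K).range) : ∃ ι : RatFunc ℂ →ₐ[ℂ] K, ι RatFunc.X = θ := by
  have htr : Transcendental ℂ θ := fun halg => hθ (minpoly.mem_range_of_degree_eq_one ℂ θ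
    (IsAlgClosed.degree_eq_one_of_irreducible ℂ (minpoly.irreducible halg.isIntegral)))
  refine ⟨RatFunc.liftAlgHom (Polynomial.aeval θ)
    (nonZeroDivisors_le_comap_nonZeroDivisors_of_injective _
      (transcendental_iff_injective.1 htr)), ?_⟩
  have h := RatFunc.liftAlgHom_apply_div (Polynomial.aeval θ)
    (nonZeroDivisors_le_comap_nonZeroDivisors_of_injective _
      (transcendental_iff_injective.1 htr)) Polynomial.X 1
  simpa using h

/-- The substitution `z ↦ ι z` in rational functions satisfies the chain rule. -/
theorem deriv_algHom_ratFunc {K : Type*} [Field K] [Algebra ℂ K] [Differential K]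
    (hK : ∀ c, Differential.deriv (algebraMap ℂ K c) = 0) (ι : RatFunc ℂ →ₐ[ℂ] K) (f : RatFunc ℂ) :
    (ι f)′ = (ι RatFunc.X)′ * ι f′ := by
  refine chain_rule_of_adjoin_eq_top Differential.deriv Differential.deriv ι.toRingHom _
    (RatFunc.adjoin_X (K := ℂ)) (fun c => ?_) ?_ f
  · change (ι _)′ = _ * ι _
    rw [ι.commutes, hK, RatFunc.deriv_algebraMap, map_zero, mul_zero]
  · rintro _ rfl
    change (ι _)′ = _ * ι _
    rw [RatFunc.deriv_X, map_one, mul_one]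

end RationalFunctions

/-! ### The differential field generated by an element -/

section DiffAdjoin

variable {K : Type*} [Field K] [Algebra ℂ K] [Differential K]

/-- If `θ'` is algebraic over `ℂ(θ)`, then `ℂ⟨θ⟩ = ℂ(θ, θ')` is a finite extension of `ℂ(θ)`. -/
theorem finiteDimensional_diffAdjoin (hK : ConstantsAreComplex K) {θ : K}
    (ι : RatFunc ℂ →ₐ[ℂ] diffAdjoin θ) (hι : ι RatFunc.X = diffAdjoinGen θ)
    [Algebra.IsAlgebraic ι.fieldRange (diffAdjoin θ)] :
    @Module.Finite (RatFunc ℂ) (diffAdjoin θ) _ _ ι.toRingHom.toAlgebra.toModule := by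
  let : Algebra (RatFunc ℂ) (diffAdjoin θ) := ι.toRingHom.toAlgebra
  let : Algebra (RatFunc ℂ) K := ((algebraMap (diffAdjoin θ) K).comp ι.toRingHom).toAlgebra
  have : IsScalarTower (RatFunc ℂ) (diffAdjoin θ) K := .of_algebraMap_eq fun _ => rfl
  have : IsScalarTower ℂ (RatFunc ℂ) K := .of_algebraMap_eq fun c =>
    congrArg Subtype.val (ι.commutes c).symm
  have : Algebra.IsAlgebraic (RatFunc ℂ) (diffAdjoin θ) :=
    Algebra.IsAlgebraic.of_ringHom_of_comp_eq (S := ι.fieldRange) (B := diffAdjoin θ)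
      ι.rangeRestrict.toRingHom (RingHom.id (diffAdjoin θ)) ι.rangeRestrict_surjective
      Function.injective_id rfl
  have halg : IsAlgebraic (RatFunc ℂ) (algebraMap (diffAdjoin θ) K (diffAdjoinGen θ)′) :=
    (Algebra.IsAlgebraic.isAlgebraic (R := RatFunc ℂ) ((diffAdjoinGen θ)′)).algebraMap
  change IsAlgebraic (RatFunc ℂ) (θ′) at halg
  set S := IntermediateField.adjoin (RatFunc ℂ) {θ′}
  have hS : ∀ x ∈ S, x′ ∈ S := fun x hx =>
    derivation_mem_adjoin_simple Differential.deriv halg (fun f => by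
      have h1 : Differential.deriv (algebraMap (RatFunc ℂ) K f) =
          θ′ * algebraMap (RatFunc ℂ) K f′ := by
        have h2 := deriv_algHom_ratFunc hK.deriv_algebraMap ((diffAdjoin θ).val.comp ι) f
        have h3 : ((diffAdjoin θ).val.comp ι) RatFunc.X = θ := congrArg Subtype.val hι
        rwa [h3] at h2
      rw [h1]
      exact mul_mem (IntermediateField.mem_adjoin_simple_self _ _)
        (IntermediateField.algebraMap_mem _ _)) hx
  have hle : ∀ x ∈ diffAdjoin θ, x ∈ S := fun x hx =>
    (mem_diffAdjoin_iff θ).1 hx (S.restrictScalars ℂ)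
      (by
        have h1 : algebraMap (RatFunc ℂ) K RatFunc.X = θ := congrArg Subtype.val hι
        exact h1 ▸ S.algebraMap_mem RatFunc.X) hS
  have : FiniteDimensional (RatFunc ℂ) S :=
    IntermediateField.adjoin.finiteDimensional halg.isIntegral
  let e : diffAdjoin θ →ₗ[RatFunc ℂ] S :=
    { toFun := fun x => ⟨x, hle x x.2⟩
      map_add' := fun _ _ => rfl
      map_smul' := fun c x => by
        apply Subtype.ext
        change ((c • x : diffAdjoin θ) : K) = c • (x : K)
        rw [Algebra.smul_def, Algebra.smul_def]
        rfl }
  exact Module.Finite.of_injective e fun x y h => Subtype.ext (congrArg (fun z : S => (z : K)) h)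

end DiffAdjoin

/-! ### Existence of the substitution -/

section Substitution

variable {K : Type*} [Field K] [Algebra ℂ K] [Differential K] {θ : K}

/-- A substitution restricts to `ι` on the rational functions. -/
theorem IsSubstitution.apply_algebraMap {ι : RatFunc ℂ →ₐ[ℂ] diffAdjoin θ}
    (hι : ι RatFunc.X = diffAdjoinGen θ) {E M : Type*} [Field E] [Algebra ℂ E]
    [Algebra (RatFunc ℂ) E] [IsScalarTower ℂ (RatFunc ℂ) E] [Differential E] [Field M] [Algebra ℂ M]
    [Algebra (diffAdjoin θ) M] [IsScalarTower ℂ (diffAdjoin θ) M] [Differential M] {φ : E →ₐ[ℂ] M}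
    (hφ : IsSubstitution (algebraMap (diffAdjoin θ) M (diffAdjoinGen θ)) φ) (f : RatFunc ℂ) :
    φ (algebraMap (RatFunc ℂ) E f) = algebraMap (diffAdjoin θ) M (ι f) := by
  have h : φ.comp (IsScalarTower.toAlgHom ℂ (RatFunc ℂ) E) =
      (IsScalarTower.toAlgHom ℂ (diffAdjoin θ) M).comp ι :=
    RatFunc.algHom_eq_of_apply_X (hφ.map_z.trans (congrArg _ hι.symm))
  exact DFunLike.congr_fun h f

/-- The derivation `d/dθ = (1 / θ') ∂` of `M` extends `d/dz` on `ℂ(z)`, so a Picard-Vessiot extension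
of `ℂ(z)` embeds into `M` once `M` contains a fundamental system. -/
theorem exists_isSubstitution {ι : RatFunc ℂ →ₐ[ℂ] diffAdjoin θ}
    (hK : ConstantsAreComplex K) (hθ : θ′ ≠ 0) (hι : ι RatFunc.X = diffAdjoinGen θ)
    {a b : RatFunc ℂ} {L : Type*} [Field L] [Algebra ℂ L] [Algebra (RatFunc ℂ) L]
    [IsScalarTower ℂ (RatFunc ℂ) L] [Differential L] [DifferentialAlgebra (RatFunc ℂ) L]
    (hL : IsPicardVessiot L a b) {a₁ b₁ : diffAdjoin θ}
    (ha : a₁ = ι a * (diffAdjoinGen θ)′ - (diffAdjoinGen θ)′′ / (diffAdjoinGen θ)′)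
    (hb : b₁ = ι b * (diffAdjoinGen θ)′ ^ 2) {M : Type*} [Field M] [Algebra ℂ M]
    [Algebra (diffAdjoin θ) M] [IsScalarTower ℂ (diffAdjoin θ) M] [Differential M]
    [DifferentialAlgebra (diffAdjoin θ) M] (hM : IsPicardVessiot M a₁ b₁) :
    ∃ φ : L →ₐ[ℂ] M, IsSubstitution (algebraMap (diffAdjoin θ) M (diffAdjoinGen θ)) φ := by
  let : Algebra (RatFunc ℂ) M := ((algebraMap (diffAdjoin θ) M).comp ι.toRingHom).toAlgebra
  have halg : ∀ f, algebraMap (RatFunc ℂ) M f = algebraMap (diffAdjoin θ) M (ι f) := fun _ => rfl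
  have : IsScalarTower ℂ (RatFunc ℂ) M := .of_algebraMap_eq fun c => by
    rw [halg, ι.commutes, ← IsScalarTower.algebraMap_apply]
  have hg : (diffAdjoinGen θ)′ ≠ 0 := fun h => hθ (congrArg Subtype.val h)
  set t : M := algebraMap (diffAdjoin θ) M (diffAdjoinGen θ)′ with ht
  have ht0 : t ≠ 0 := (map_ne_zero _).2 hg
  let d : Derivation ℤ M M := t⁻¹ • Differential.deriv
  have hd : ∀ m, d m = t⁻¹ * m′ := fun _ => rfl
  have hι' : ∀ f, (ι f)′ = (diffAdjoinGen θ)′ * ι f′ := fun f => by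
    rw [deriv_algHom_ratFunc (fun c => Subtype.ext (hK.deriv_algebraMap c)) ι f, hι]
  obtain ⟨r, hr, -⟩ := hM.generated
  obtain ⟨φ, hφ⟩ := hL.exists_algHom d
    (fun f => by
      rw [hd, halg, halg, deriv_algebraMap_eq]
      change t⁻¹ * algebraMap _ _ (ι f)′ = _
      rw [hι', map_mul, inv_mul_cancel_left₀ ht0])
    (fun m => by rw [hd, mul_eq_zero, or_iff_right (inv_ne_zero ht0), hM.constants])
    hr.linearIndependent
    (fun i => by
      have h1 := hr.solution i
      have ha' : algebraMap (diffAdjoin θ) M a₁ = algebraMap (RatFunc ℂ) M a * t - t′ / t := by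
        rw [ha, map_sub, map_mul, map_div₀, ht, deriv_algebraMap_eq, halg]
      have hb' : algebraMap (diffAdjoin θ) M b₁ = algebraMap (RatFunc ℂ) M b * t ^ 2 := by
        rw [hb, map_mul, map_pow, halg]
      rw [secondOrderOp, ha', hb'] at h1
      have h2 : d (d (r i)) = t⁻¹ * (t⁻¹ * (r i)′′ - t′ / t ^ 2 * (r i)′) := by
        rw [hd, hd, Derivation.leibniz, Derivation.leibniz_inv]
        simp only [smul_eq_mul]
        field_simp
        ring
      rw [h2, hd]
      have h3 : t ^ 2 * (t⁻¹ * (t⁻¹ * (r i)′′ - t′ / t ^ 2 * (r i)′) +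
          algebraMap (RatFunc ℂ) M a * (t⁻¹ * (r i)′) + algebraMap (RatFunc ℂ) M b * r i) =
          0 := by
        rw [← h1]
        field_simp
        ring
      exact (mul_eq_zero.1 h3).resolve_left (pow_ne_zero 2 ht0))
  refine ⟨φ.restrictScalars ℂ, ⟨?_, fun f => ?_⟩⟩
  · change φ _ = _
    rw [φ.commutes, halg, hι]
  · change (φ f)′ = _ * φ f′
    rw [← hφ, hd, deriv_algebraMap_eq, mul_inv_cancel_left₀ ht0]

end Substitution

end

/-! ### The change of variable in a second order equation -/

theorem proposition2p3p2
    -- the differential field `(K, δ)` with constants `ℂ`, and a non-constant element `θ`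
    {K : Type u} [Field K] [Algebra ℂ K] [Differential K] (hK : ConstantsAreComplex K)
    (θ : K) (hθ : θ′ ≠ 0)
    -- the equation `y'' + a y' + b y = 0` over `ℂ(z)` and its Picard-Vessiot extension `L`
    (a b : RatFunc ℂ)
    {L : Type v} [Field L] [Algebra ℂ L] [Algebra (RatFunc ℂ) L] [IsScalarTower ℂ (RatFunc ℂ) L]
    [Differential L] [DifferentialAlgebra (RatFunc ℂ) L] (hL : IsPicardVessiot L a b) :
    -- the embedding `ι : ℂ(z) → K₀ = ℂ⟨θ⟩`, `z ↦ θ`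
    ∃ ι : RatFunc ℂ →ₐ[ℂ] diffAdjoin θ, (ι RatFunc.X : K) = θ ∧
      -- the coefficients of the transformed equation lie in `K₀`
      ∃ a₁ b₁ : diffAdjoin θ,
        (a₁ : K) = ι a * θ′ - θ′′ / θ′ ∧ (b₁ : K) = ι b * θ′ ^ 2 ∧
        -- `r = y ∘ θ` transforms the first equation into the second one
        (∀ (E : Type v) [Field E] [Algebra ℂ E] [Algebra (RatFunc ℂ) E]
            [IsScalarTower ℂ (RatFunc ℂ) E] [Differential E] [DifferentialAlgebra (RatFunc ℂ) E]
            (M : Type w) [Field M] [Algebra ℂ M] [Algebra (diffAdjoin θ) M]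
            [IsScalarTower ℂ (diffAdjoin θ) M] [Differential M]
            [DifferentialAlgebra (diffAdjoin θ) M] (φ : E →ₐ[ℂ] M),
            IsSubstitution (algebraMap (diffAdjoin θ) M (diffAdjoinGen θ)) φ →
            ∀ y : E, secondOrderOp M a₁ b₁ (φ y) =
              algebraMap (diffAdjoin θ) M (diffAdjoinGen θ)′ ^ 2 * φ (secondOrderOp E a b y)) ∧
        -- the Picard-Vessiot extension `L₀` of `K₀` for the second equation
        ∀ (L₀ : Type w) [Field L₀] [Algebra ℂ L₀] [Algebra (diffAdjoin θ) L₀]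
          [IsScalarTower ℂ (diffAdjoin θ) L₀] [Differential L₀]
          [DifferentialAlgebra (diffAdjoin θ) L₀], IsPicardVessiot L₀ a₁ b₁ →
          (∃ φ : L →ₐ[ℂ] L₀,
            IsSubstitution (algebraMap (diffAdjoin θ) L₀ (diffAdjoinGen θ)) φ) ∧
          ∀ φ : L →ₐ[ℂ] L₀,
            IsSubstitution (algebraMap (diffAdjoin θ) L₀ (diffAdjoinGen θ)) φ →
            ∀ y : Fin 2 → L, IsFundamentalSystem L a b y →
              IsFundamentalSystem L₀ a₁ b₁ (fun i => φ (y i)) ∧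
              (Algebra.IsAlgebraic ι.fieldRange (diffAdjoin θ) →
                identityComponent (DGalMatrix (diffAdjoin θ) fun i => φ (y i)) =
                  identityComponent (DGalMatrix (RatFunc ℂ) y)) := by
  have hθr : diffAdjoinGen θ ∉ (algebraMap ℂ (diffAdjoin θ)).range := by
    rintro ⟨c, hc⟩
    apply hθ
    rw [show θ = algebraMap ℂ K c from (congrArg Subtype.val hc).symm]
    exact hK.deriv_algebraMap c
  obtain ⟨ι, hι⟩ := exists_algHom_ratFunc (diffAdjoinGen θ) hθr
  refine ⟨ι, congrArg Subtype.val hι,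
    ι a * (diffAdjoinGen θ)′ - (diffAdjoinGen θ)′′ / (diffAdjoinGen θ)′,
    ι b * (diffAdjoinGen θ)′ ^ 2, rfl, rfl, ?_⟩
  have hg : (diffAdjoinGen θ)′ ≠ 0 := fun h => hθ (congrArg Subtype.val h)
  set a₁ := ι a * (diffAdjoinGen θ)′ - (diffAdjoinGen θ)′′ / (diffAdjoinGen θ)′ with ha₁
  set b₁ := ι b * (diffAdjoinGen θ)′ ^ 2 with hb₁
  have hop : ∀ (E : Type v) [Field E] [Algebra ℂ E] [Algebra (RatFunc ℂ) E]
      [IsScalarTower ℂ (RatFunc ℂ) E] [Differential E] [DifferentialAlgebra (RatFunc ℂ) E]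
      (M : Type w) [Field M] [Algebra ℂ M] [Algebra (diffAdjoin θ) M]
      [IsScalarTower ℂ (diffAdjoin θ) M] [Differential M]
      [DifferentialAlgebra (diffAdjoin θ) M] (φ : E →ₐ[ℂ] M),
      IsSubstitution (algebraMap (diffAdjoin θ) M (diffAdjoinGen θ)) φ →
      ∀ y : E, secondOrderOp M a₁ b₁ (φ y) =
        algebraMap (diffAdjoin θ) M (diffAdjoinGen θ)′ ^ 2 * φ (secondOrderOp E a b y) := by
    intro E _ _ _ _ _ _ M _ _ _ _ _ _ φ hφ y
    refine secondOrderOp_of_chain_rule φ.toRingHom ((map_ne_zero _).2 hg) (fun f => ?_) ?_ ?_ y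
    · rw [← deriv_algebraMap_eq]
      exact hφ.chain_rule f
    · change _ = φ _ * _ - _
      rw [hφ.apply_algebraMap hι, ha₁, map_sub, map_mul, map_div₀, deriv_algebraMap_eq]
    · change _ = φ _ * _
      rw [hφ.apply_algebraMap hι, hb₁, map_mul, map_pow]
  refine ⟨hop, ?_⟩
  intro L₀ _ _ _ _ _ _ hL₀
  refine ⟨exists_isSubstitution hK hθ hι hL ha₁ hb₁ hL₀, fun φ hφ y hy => ?_⟩
  have hφy : IsFundamentalSystem L₀ a₁ b₁ fun i => φ (y i) :=
    hL₀.isFundamentalSystem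
      (fun i => by rw [hop L L₀ φ hφ, hy.solution, map_zero, mul_zero])
      (hy.linearIndependent.map' φ.toLinearMap (LinearMap.ker_eq_bot.2 φ.injective))
  refine ⟨hφy, fun halg => ?_⟩
  let : Algebra (RatFunc ℂ) (diffAdjoin θ) := ι.toRingHom.toAlgebra
  let : Algebra (RatFunc ℂ) L₀ := ((algebraMap (diffAdjoin θ) L₀).comp ι.toRingHom).toAlgebra
  have : IsScalarTower (RatFunc ℂ) (diffAdjoin θ) L₀ := .of_algebraMap_eq fun _ => rfl
  have : IsScalarTower ℂ (RatFunc ℂ) L₀ := .of_algebraMap_eq fun c => by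
    change _ = algebraMap (diffAdjoin θ) L₀ (ι _)
    rw [ι.commutes, ← IsScalarTower.algebraMap_apply]
  have : FiniteDimensional (RatFunc ℂ) (diffAdjoin θ) := finiteDimensional_diffAdjoin hK ι hι
  let φF : L →ₐ[RatFunc ℂ] L₀ :=
    { φ.toRingHom with commutes' := fun f => hφ.apply_algebraMap hι f }
  exact identityComponent_eq_of_chain_rule hL hL₀ hg φF
    (fun f => by rw [← deriv_algebraMap_eq]; exact hφ.chain_rule f) hy hφy
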